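/- Let $d\ge 1$ and $\beta>0$. For every finite $X\subset\mathbb Z^d$ let $\Delta_X,m_X,\mu'_X\in\mathbb R$ be given, and assume thermodynamic stability: there is $\bar c<\infty$ such that for every nonempty finite $\Lambda\subset\mathbb Z^d$ $$\frac1{|\Lambda|}\sum_{X\subseteq\Lambda}|m_X|\le\bar c,\qquad \frac1{|\Lambda|}\sum_{X\subseteq\Lambda}|\mu'_X|\le\bar c,\qquad \frac1{|\Lambda|}\sum_{X\subseteq\Lambda}\Delta_X^2\le\bar c .$$ For finite $\Lambda'\subseteq\Lambda\subset\mathbb Z^d$ and $\mu\in\mathbb R$ let $J_X$, $X\subseteq\Lambda$, be independent Gaussian variables with variance $\Delta_X^2$ and with mean $\mu\mu'_X$ if $X\subseteq\Lambda'$ and $m_X$ otherwise, let $\widetilde J$ be an independent copy of $J$, and write $\mathrm{Av}$ for the average over $(J,\widetilde J)$. For $\sigma\in\{-1,1\}^\Lambda$ put $\sigma_X=\prod_{i\in X}\sigma_i$ (with $\sigma_\emptyset=0$) and, for $t\in[0,\pi]$, $$X_{\Lambda,t}(\sigma)=-\cos t\sum_{X\subseteq\Lambda'}J_X\sigma_X-\sin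 t\sum_{X\subseteq\Lambda'}\widetilde J_X\sigma_X-\sum_{X\subseteq\Lambda,\;X\not\subseteq\Lambda'}J_X\sigma_X .$$ Let $\omega_t$ be the random Gibbs state with weights proportional to $e^{-\beta X_{\Lambda,t}(\sigma)}$, and let $\langle\,\cdot\,\rangle_{t_1,\dots,t_n;\mu}=\mathrm{Av}\big[(\omega_{t_1}\otimes\cdots\otimes\omega_{t_n})(\,\cdot\,)\big]$ be the quenched state of $n$ replicas with the same disorder. Let $c^{\Lambda'}_{k,l}=\frac1{|\Lambda'|}\sum_{X\subseteq\Lambda'}\Delta_X^2\,\sigma^{(k)}_X\sigma^{(l)}_X$ be the normalized covariance in $\Lambda'$ of the replicas $k$ and $l$. Then for every $a>0$ and every interval $[\mu_1,\mu_2]$ $$\lim_{\substack{\Lambda,\Lambda'\nearrow\mathbb Z^d\\ |\Lambda'|/|\Lambda|\to a}}\int_{\mu_1}^{\mu_2}d\mu\int_0^\pi\!\!\int_0^\pi dt\,ds\,\sin^2(t-s)\Big[\big\langle (c^{\Lambda'}_{1,2})^2\big\rangle_{t,s;\mu}-2\big\langle c^{\Lambda'}_{1,2}c^{\Lambda'}_{2,3}\big\rangle_{s,t,s;\mu}+\big\langle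 c^{\Lambda'}_{1,2}c^{\Lambda'}_{3,4}\big\rangle_{t,s,s,t;\mu}\Big]=0 ,$$ where the limit is along arbitrary sequences of finite sets $\Lambda'_n\subseteq\Lambda_n$, each of which eventually contains every finite subset of $\mathbb Z^d$, with $|\Lambda'_n|/|\Lambda_n|\to a$. -/

import Mathlib

open Filter Topology MeasureTheory ProbabilityTheory

noncomputable section

namespace SpinFlip

/-- Sites of the lattice `ℤ^d`. -/
abbrev Site (d : ℕ) : Type := Fin d → ℤ

/-- Ising configurations on `Λ`: every site carries a spin `±1`. -/
abbrev Config {d : ℕ} (Λ : Finset (Site d)) : Type := ↥Λ → ℤˣ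

/-- One real coupling `J_X` for each `X ⊆ Λ`. -/
abbrev Couplings {d : ℕ} (Λ : Finset (Site d)) : Type := ↥Λ.powerset → ℝ

/-- `σ_X = ∏_{i ∈ X} σ_i` for `X ⊆ Λ`, with the convention `σ_∅ = 0`. -/
def spinProd {d : ℕ} {Λ : Finset (Site d)} (σ : Config Λ) (X : Finset (Site d)) : ℝ :=
  if X = ∅ then 0 else ∏ i : ↥Λ, if (i : Site d) ∈ X then (((σ i : ℤˣ) : ℤ) : ℝ) else 1

/-- `H_{Λ'}(σ) = -∑_{X ⊆ Λ'} J_X σ_X`. -/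
def hamIn {d : ℕ} {Λ : Finset (Site d)} (Λ' : Finset (Site d)) (J : Couplings Λ)
    (σ : Config Λ) : ℝ :=
  -∑ X : ↥Λ.powerset, if (X : Finset (Site d)) ⊆ Λ' then J X * spinProd σ X else 0

/-- `H_{Λ \ Λ'}(σ) = -∑_{X ⊆ Λ, X ⊄ Λ'} J_X σ_X`. -/
def hamOut {d : ℕ} {Λ : Finset (Site d)} (Λ' : Finset (Site d)) (J : Couplings Λ)
    (σ : Config Λ) : ℝ :=
  -∑ X : ↥Λ.powerset, if (X : Finset (Site d)) ⊆ Λ' then 0 else J X * spinProd σ X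

/-- The trigonometric interpolation of the full flip,
`X_{Λ,t}(σ) = cos t H_{Λ'}(σ) + sin t H̃_{Λ'}(σ) + H_{Λ \ Λ'}(σ)`;
the disorder is the pair `ω = (J, J̃)`. -/
def interpHam {d : ℕ} {Λ : Finset (Site d)} (Λ' : Finset (Site d)) (t : ℝ)
    (ω : Couplings Λ × Couplings Λ) (σ : Config Λ) : ℝ :=
  Real.cos t * hamIn Λ' ω.1 σ + Real.sin t * hamIn Λ' ω.2 σ + hamOut Λ' ω.1 σ

/-- The interpolated partition function `Z_β(t) = ∑_σ exp(-β X_{Λ,t}(σ))`. -/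
def partitionFn {d : ℕ} {Λ : Finset (Site d)} (β : ℝ) (Λ' : Finset (Site d)) (t : ℝ)
    (ω : Couplings Λ × Couplings Λ) : ℝ :=
  ∑ σ : Config Λ, Real.exp (-β * interpHam Λ' t ω σ)

/-- The random state `ω_{t_1,…,t_n} = ω_{t_1} ⊗ ⋯ ⊗ ω_{t_n}` on `n` replicas that share the
same disorder. -/
def randomState {d : ℕ} {Λ : Finset (Site d)} (β : ℝ) (Λ' : Finset (Site d)) {n : ℕ}
    (t : Fin n → ℝ) (ω : Couplings Λ × Couplings Λ) (f : (Fin n → Config Λ) → ℝ) : ℝ :=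
  (∏ k, (partitionFn β Λ' (t k) ω)⁻¹) *
    ∑ σ : Fin n → Config Λ, f σ * ∏ k, Real.exp (-β * interpHam Λ' (t k) ω (σ k))

/-- The means of the disorder: `μ μ'_X` for `X ⊆ Λ'`, and `m_X` for all the other `X`. -/
def paramMean {d : ℕ} (m m' : Finset (Site d) → ℝ) (Λ' : Finset (Site d)) (μ : ℝ)
    (X : Finset (Site d)) : ℝ :=
  if X ⊆ Λ' then μ * m' X else m X

/-- The law of independent Gaussian couplings `J_X`, `X ⊆ Λ`, with means `mean X` and
variances `Δ_X ^ 2`. -/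
def couplingLaw {d : ℕ} (Λ : Finset (Site d)) (mean Δ : Finset (Site d) → ℝ) :
    Measure (Couplings Λ) :=
  Measure.pi fun X : ↥Λ.powerset => gaussianReal (mean X) ⟨Δ X ^ 2, sq_nonneg _⟩

/-- The law of `(J, J̃)`, where `J̃` is an independent copy of `J`. -/
def disorderLaw {d : ℕ} (Λ : Finset (Site d)) (mean Δ : Finset (Site d) → ℝ) :
    Measure (Couplings Λ × Couplings Λ) :=
  (couplingLaw Λ mean Δ).prod (couplingLaw Λ mean Δ)

/-- The quenched state `⟨f⟩_{t_1,…,t_n;μ} = Av(ω_{t_1,…,t_n}(f))`. -/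
def quenched {d : ℕ} (β : ℝ) (Δ m m' : Finset (Site d) → ℝ) (Λ Λ' : Finset (Site d)) (μ : ℝ)
    {n : ℕ} (t : Fin n → ℝ) (f : (Fin n → Config Λ) → ℝ) : ℝ :=
  ∫ ω, randomState β Λ' t ω f ∂(disorderLaw Λ (paramMean m m' Λ' μ) Δ)

/-- The normalized covariance `c_{Λ'}(σ,τ) = |Λ'|⁻¹ ∑_{X ⊆ Λ'} Δ_X ^ 2 σ_X τ_X`. -/
def normCov {d : ℕ} {Λ : Finset (Site d)} (Δ : Finset (Site d) → ℝ) (Λ' : Finset (Site d))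
    (σ τ : Config Λ) : ℝ :=
  (∑ X ∈ Λ'.powerset, Δ X ^ 2 * spinProd σ X * spinProd τ X) / (Λ'.card : ℝ)

/-- The polynomial `⟨c_{1,2}²⟩_{t,s;μ} - 2 ⟨c_{1,2} c_{2,3}⟩_{s,t,s;μ} + ⟨c_{1,2} c_{3,4}⟩_{t,s,s,t;μ}`.
Replicas are numbered from `0`. -/
def repliconPoly {d : ℕ} (β : ℝ) (Δ m m' : Finset (Site d) → ℝ) (Λ Λ' : Finset (Site d))
    (μ t s : ℝ) : ℝ :=
  quenched β Δ m m' Λ Λ' μ ![t, s] (fun σ => normCov Δ Λ' (σ 0) (σ 1) ^ 2)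
    - 2 * quenched β Δ m m' Λ Λ' μ ![s, t, s]
        (fun σ => normCov Δ Λ' (σ 0) (σ 1) * normCov Δ Λ' (σ 1) (σ 2))
    + quenched β Δ m m' Λ Λ' μ ![t, s, s, t]
        (fun σ => normCov Δ Λ' (σ 0) (σ 1) * normCov Δ Λ' (σ 2) (σ 3))

/-- Thermodynamic stability for means `mean X` and variances `Δ_X ^ 2`. -/
def ThermStable {d : ℕ} (mean Δ : Finset (Site d) → ℝ) : Prop :=
  ∃ c : ℝ, ∀ Λ : Finset (Site d), Λ.Nonempty →
    (∑ X ∈ Λ.powerset, |mean X|) / (Λ.card : ℝ) ≤ c ∧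
    (∑ X ∈ Λ.powerset, Δ X ^ 2) / (Λ.card : ℝ) ≤ c

end SpinFlip

end

/-!
Rotating the couplings `(J_X, J̃_X)`, `X ⊆ Λ'`, by the angle `π` flips the sign of the couplings in
`Λ'`, and the resulting change of the pressure `log Z` is the integral of its derivative, the flow,
over `t ∈ [0, π]`. By the Efron-Stein inequality the pressure has variance `O(|Λ|)`, and hence so
has its change under the flip. On the other hand, Gaussian integration by parts expresses the second
moment of the flow through the integral of `sin² (t - s)` against the replicon polynomial, of order
`|Λ'|²`, up to terms of order `|Λ|` and the covariance of the magnetization `∑ μ'_X ω_t(σ_X)`, which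
the means of the couplings bring in.

That magnetization is up to a constant the `μ`-derivative of the pressure. The pressure is convex
in `μ` and fluctuates by `O(√|Λ|)`, so its slopes over intervals of length `δ` fluctuate by
`O(√|Λ| / δ)`, while the error made in replacing the derivative by a slope integrates over `μ` to
`O(|Λ'| δ)`. So the variance of the magnetization is `o(|Λ'|²)` on average over `μ`.
-/

noncomputable section

namespace SpinFlip

section Variance

variable {Ω : Type*} [MeasurableSpace Ω] {P : Measure Ω} [IsProbabilityMeasure P]

lemma variance_fun_add_le {X Y : Ω → ℝ} (hX : MemLp X 2 P) (hY : MemLp Y 2 P) :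
    Var[fun ω => X ω + Y ω; P] ≤ 2 * Var[X; P] + 2 * Var[Y; P] := by
  have h_add := variance_fun_add hX hY
  have h_sub := variance_fun_sub hX hY
  have h_nonneg := variance_nonneg (fun ω => X ω - Y ω) P
  linarith

lemma variance_fun_sub_le {X Y : Ω → ℝ} (hX : MemLp X 2 P) (hY : MemLp Y 2 P) :
    Var[fun ω => X ω - Y ω; P] ≤ 2 * Var[X; P] + 2 * Var[Y; P] := by
  have h_add := variance_fun_add hX hY
  have h_sub := variance_fun_sub hX hY
  have h_nonneg := variance_nonneg (fun ω => X ω + Y ω) P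
  linarith

lemma variance_le_variance_add_integral_sq {X Y : Ω → ℝ} (hX : MemLp X 2 P) (hY : MemLp Y 2 P) :
    Var[X; P] ≤ 2 * Var[Y; P] + 2 * ∫ ω, (X ω - Y ω) ^ 2 ∂P := by
  have h_split : Var[X; P] = Var[fun ω => Y ω + (X ω - Y ω); P] := by simp
  have h_diff : Var[fun ω => X ω - Y ω; P] ≤ ∫ ω, (X ω - Y ω) ^ 2 ∂P :=
    variance_le_expectation_sq (hX.sub hY).aestronglyMeasurable
  have h_add : Var[fun ω => Y ω + (X ω - Y ω); P]
      ≤ 2 * Var[Y; P] + 2 * Var[fun ω => X ω - Y ω; P] := variance_fun_add_le hY (hX.sub hY)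
  linarith

lemma variance_le_sq_mul_variance_id {ν : Measure ℝ} [IsProbabilityMeasure ν]
    (hν : MemLp id 2 ν) {f : ℝ → ℝ} (hf : AEStronglyMeasurable f ν) {a : ℝ}
    (hfa : ∀ x y, |f x - f y| ≤ a * |x - y|) : Var[f; ν] ≤ a ^ 2 * Var[id; ν] := by
  set c := ∫ x, x ∂ν
  have h_bound (x : ℝ) : (f x - f c) ^ 2 ≤ a ^ 2 * (x - c) ^ 2 := by
    rw [← mul_pow, sq_le_sq, abs_mul]
    exact (hfa x c).trans (mul_le_mul_of_nonneg_right (le_abs_self a) (abs_nonneg _))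
  have h_int : Integrable (fun x => a ^ 2 * (x - c) ^ 2) ν :=
    ((hν.sub (memLp_const c)).integrable_sq).const_mul _
  calc Var[f; ν] = Var[fun x => f x - f c; ν] := (variance_sub_const hf _).symm
    _ ≤ ∫ x, (f x - f c) ^ 2 ∂ν := variance_le_expectation_sq (hf.sub aestronglyMeasurable_const)
    _ ≤ ∫ x, a ^ 2 * (x - c) ^ 2 ∂ν :=
        integral_mono_of_nonneg (ae_of_all _ fun x => sq_nonneg _) h_int (ae_of_all _ h_bound)
    _ = a ^ 2 * Var[id; ν] := by
        rw [integral_const_mul, variance_eq_integral measurable_id.aemeasurable]; rfl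

lemma variance_prod_eq_integral_variance_add {α β : Type*} [MeasurableSpace α] [MeasurableSpace β]
    {μ : Measure α} {ν : Measure β} [IsProbabilityMeasure μ] [IsProbabilityMeasure ν]
    {f : α × β → ℝ} (hf : MemLp f 2 (μ.prod ν)) :
    Var[f; μ.prod ν]
      = ∫ x, Var[fun y => f (x, y); ν] ∂μ + Var[fun x => ∫ y, f (x, y) ∂ν; μ] := by
  set m : α → ℝ := fun x => ∫ y, f (x, y) ∂ν with hm
  have h_sq := hf.integrable_sq
  have hm_meas : AEStronglyMeasurable m μ := hf.aestronglyMeasurable.integral_prod_right'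
  have h_section : ∀ᵐ x ∂μ, Var[fun y => f (x, y); ν] = ∫ y, f (x, y) ^ 2 ∂ν - m x ^ 2 := by
    filter_upwards [h_sq.prod_right_ae, hf.aestronglyMeasurable.prodMk_left] with x hx hx_meas
    exact variance_eq_sub ((memLp_two_iff_integrable_sq hx_meas).2 hx)
  have hm_sq : Integrable (fun x => m x ^ 2) μ := by
    refine h_sq.integral_prod_left.mono' (hm_meas.pow 2) ?_
    filter_upwards [h_section] with x hx
    rw [Real.norm_of_nonneg (sq_nonneg _)]
    exact sub_nonneg.1 (hx ▸ variance_nonneg _ _)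
  have hm_lp : MemLp m 2 μ := (memLp_two_iff_integrable_sq hm_meas).2 hm_sq
  rw [integral_congr_ae h_section, integral_sub h_sq.integral_prod_left hm_sq,
    variance_eq_sub hf, variance_eq_sub hm_lp]
  simp only [Pi.pow_apply, hm, ← integral_prod f (hf.integrable one_le_two),
    integral_prod (fun z => f z ^ 2) h_sq]
  ring

end Variance

section ResampleCoordinate

variable {κ : Type*} [Fintype κ] [DecidableEq κ] {α : κ → Type*} [∀ k, MeasurableSpace (α k)]
  {ν : ∀ k, Measure (α k)} [∀ k, IsProbabilityMeasure (ν k)]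

lemma measurePreserving_update (k : κ) :
    MeasurePreserving (fun p : (∀ i, α i) × α k => Function.update p.1 k p.2)
      ((Measure.pi ν).prod (ν k)) (Measure.pi ν) := by
  refine ⟨measurable_update', (Measure.pi_eq fun s hs => ?_).symm⟩
  have h_preimage : (fun p : (∀ i, α i) × α k => Function.update p.1 k p.2) ⁻¹' Set.univ.pi s
      = Set.univ.pi (Function.update s k Set.univ) ×ˢ s k := by
    ext ⟨g, x⟩
    simp only [Set.mem_preimage, Set.mem_univ_pi, Set.mem_prod]
    rw [Function.forall_update_iff g fun i y => y ∈ s i,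
      Function.forall_update_iff s fun i t => g i ∈ t]
    simp [and_comm]
  rw [Measure.map_apply measurable_update' (MeasurableSet.univ_pi hs), h_preimage,
    Measure.prod_prod, Measure.pi_pi, ← Finset.prod_erase_mul _ _ (Finset.mem_univ k),
    ← Finset.prod_erase_mul (a := k) _ (fun i => ν i (s i)) (Finset.mem_univ k)]
  simp only [Function.update_self, measure_univ, mul_one]
  congr 1
  refine Finset.prod_congr rfl fun i hi => ?_
  rw [Function.update_of_ne (Finset.ne_of_mem_erase hi)]

lemma integral_eq_integral_update (k : κ) {G : (∀ i, α i) → ℝ} (hG : Integrable G (Measure.pi ν)) :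
    ∫ g, G g ∂Measure.pi ν = ∫ g, ∫ x, G (Function.update g k x) ∂ν k ∂Measure.pi ν := by
  have hmp := measurePreserving_update (ν := ν) k
  rw [← integral_prod (fun p : (∀ i, α i) × α k => G (Function.update p.1 k p.2))
    (hmp.integrable_comp_of_integrable hG), ← integral_map hmp.measurable.aemeasurable,
    hmp.map_eq]
  rw [hmp.map_eq]
  exact hG.aestronglyMeasurable

lemma variance_eq_integral_variance_update_add (k : κ) {f : (∀ i, α i) → ℝ}
    (hf : MemLp f 2 (Measure.pi ν)) :
    Var[f; Measure.pi ν] = ∫ g, Var[fun x => f (Function.update g k x); ν k] ∂Measure.pi ν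
      + Var[fun g => ∫ x, f (Function.update g k x) ∂ν k; Measure.pi ν] := by
  have hmp := measurePreserving_update (ν := ν) k
  rw [← hmp.variance_fun_comp hf.aestronglyMeasurable.aemeasurable]
  exact variance_prod_eq_integral_variance_add (hf.comp_measurePreserving hmp)

end ResampleCoordinate

/-- Functions of finitely many real variables that are Lipschitz in each coordinate `k`, with
constant `l k`: the class on which the Efron–Stein inequality is used. -/
def CoordLipschitz {κ : Type*} [Fintype κ] (l : κ → ℝ) (f : (κ → ℝ) → ℝ) : Prop :=
  ∀ x y, |f x - f y| ≤ ∑ k, l k * |x k - y k|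

namespace CoordLipschitz

variable {κ : Type*} [Fintype κ] {l : κ → ℝ} {f : (κ → ℝ) → ℝ}

lemma continuous (hf : CoordLipschitz l f) : Continuous f := by
  rw [continuous_iff_continuousAt]
  intro x
  rw [ContinuousAt, tendsto_iff_dist_tendsto_zero]
  have h_bound : Continuous fun y : κ → ℝ => ∑ k, l k * |y k - x k| := by fun_prop
  exact squeeze_zero (fun _ => dist_nonneg) (fun y => hf y x) (by simpa using h_bound.tendsto x)

lemma abs_update_sub_le [DecidableEq κ] (hf : CoordLipschitz l f) (k : κ) (g : κ → ℝ) (x y : ℝ) :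
    |f (Function.update g k x) - f (Function.update g k y)| ≤ l k * |x - y| := by
  refine (hf _ _).trans_eq ?_
  rw [Finset.sum_eq_single k (fun i _ hi => by simp [Function.update_of_ne hi]) (by simp)]
  simp

variable {ν : κ → Measure ℝ} [∀ k, IsProbabilityMeasure (ν k)]

lemma memLp_two (hν : ∀ k, MemLp id 2 (ν k)) (hf : CoordLipschitz l f) :
    MemLp f 2 (Measure.pi ν) := by
  have h_coord (k : κ) : MemLp (fun g : κ → ℝ => g k) 2 (Measure.pi ν) :=
    (hν k).comp_measurePreserving (measurePreserving_eval ν k)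
  have h_dom : MemLp (fun g => |f 0| + ∑ k, l k * |g k|) 2 (Measure.pi ν) :=
    (memLp_const |f 0|).add (memLp_finsetSum _ fun k _ => (h_coord k).abs.const_mul (l k))
  refine h_dom.mono' hf.continuous.aestronglyMeasurable (ae_of_all _ fun g => ?_)
  calc ‖f g‖ ≤ |f 0| + |f g - f 0| := by simpa using abs_add_le (f 0) (f g - f 0)
    _ ≤ |f 0| + ∑ k, l k * |g k| := by simpa using hf g 0

variable [DecidableEq κ]

lemma integrable_update (hν : ∀ k, MemLp id 2 (ν k)) (hf : CoordLipschitz l f) (k : κ)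
    (g : κ → ℝ) : Integrable (fun x => f (Function.update g k x)) (ν k) := by
  have h_dom : Integrable (fun x => |f (Function.update g k 0)| + l k * |x|) (ν k) :=
    (integrable_const _).add (((hν k).integrable one_le_two).abs.const_mul (l k))
  have h_cont : Continuous fun x => f (Function.update g k x) :=
    hf.continuous.comp (continuous_const.update k continuous_id)
  refine h_dom.mono' h_cont.aestronglyMeasurable (ae_of_all _ fun x => ?_)
  have h_lip := hf.abs_update_sub_le k g x 0
  rw [sub_zero] at h_lip
  have h_tri := abs_add_le (f (Function.update g k 0))
    (f (Function.update g k x) - f (Function.update g k 0))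
  rw [add_sub_cancel] at h_tri
  rw [Real.norm_eq_abs]
  linarith

lemma integral_update (hν : ∀ k, MemLp id 2 (ν k)) (hf : CoordLipschitz l f) (k : κ) :
    CoordLipschitz (Function.update l k 0) fun g => ∫ x, f (Function.update g k x) ∂ν k := by
  intro x y
  simp only
  rw [← integral_sub (hf.integrable_update hν k x) (hf.integrable_update hν k y),
    ← Real.norm_eq_abs]
  refine (norm_integral_le_of_norm_le_const (μ := ν k)
    (C := ∑ i, Function.update l k 0 i * |x i - y i|) (ae_of_all _ fun z => ?_)).trans_eq
    (by rw [probReal_univ, mul_one])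
  refine (hf _ _).trans_eq (Finset.sum_congr rfl fun i _ => ?_)
  rcases eq_or_ne i k with rfl | hi
  · simp
  · simp [Function.update_of_ne hi]

omit [DecidableEq κ] in
lemma variance_le_of_support (hν : ∀ k, MemLp id 2 (ν k)) (s : Finset κ)
    (hf : CoordLipschitz l f) (hs : ∀ k ∉ s, l k = 0) :
    Var[f; Measure.pi ν] ≤ ∑ k ∈ s, l k ^ 2 * Var[id; ν k] := by
  classical
  induction s using Finset.induction_on generalizing f l with
  | empty =>
    have h_const : f = fun _ => f 0 := by
      ext x
      have hx := hf x 0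
      simp only [hs _ (Finset.notMem_empty _), zero_mul, Finset.sum_const_zero] at hx
      linarith [abs_nonpos_iff.1 hx]
    rw [h_const, variance_eq_integral (by fun_prop)]
    simp
  | insert k s hk ih =>
    have h_resample (g : κ → ℝ) :
        Var[fun x => f (Function.update g k x); ν k] ≤ l k ^ 2 * Var[id; ν k] :=
      variance_le_sq_mul_variance_id (hν k) (hf.integrable_update hν k g).aestronglyMeasurable
        (hf.abs_update_sub_le k g)
    have h_inner : ∫ g, Var[fun x => f (Function.update g k x); ν k] ∂Measure.pi ν
        ≤ l k ^ 2 * Var[id; ν k] :=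
      (integral_mono_of_nonneg (ae_of_all _ fun g => variance_nonneg _ _) (integrable_const _)
        (ae_of_all _ h_resample)).trans_eq (by simp)
    have h_outer : Var[fun g => ∫ x, f (Function.update g k x) ∂ν k; Measure.pi ν]
        ≤ ∑ i ∈ s, Function.update l k 0 i ^ 2 * Var[id; ν i] := by
      refine ih (hf.integral_update hν k) fun i hi => ?_
      rcases eq_or_ne i k with rfl | hik
      · simp
      · simpa [hik] using hs i (by simp [hik, hi])
    have h_update : ∑ i ∈ s, Function.update l k 0 i ^ 2 * Var[id; ν i]
        = ∑ i ∈ s, l i ^ 2 * Var[id; ν i] :=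
      Finset.sum_congr rfl fun i hi => by
        rw [Function.update_of_ne (ne_of_mem_of_not_mem hi hk)]
    rw [variance_eq_integral_variance_update_add k (hf.memLp_two hν), Finset.sum_insert hk]
    linarith

omit [DecidableEq κ] in
lemma variance_le (hν : ∀ k, MemLp id 2 (ν k)) (hf : CoordLipschitz l f) :
    Var[f; Measure.pi ν] ≤ ∑ k, l k ^ 2 * Var[id; ν k] :=
  hf.variance_le_of_support hν Finset.univ (by simp)

end CoordLipschitz

/-- The law of a family, indexed by `κ`, of independent standard Gaussian variables. -/
abbrev stdNormal (κ : Type*) [Fintype κ] : Measure (κ → ℝ) :=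
  Measure.pi fun _ => gaussianReal 0 1

lemma integrable_one_add_norm_pow_stdNormal {κ : Type*} [Fintype κ] (n : ℕ) :
    Integrable (fun g : κ → ℝ => (1 + ‖g‖) ^ n) (stdNormal κ) := by
  have h_eval (k : κ) : MemLp (fun g : κ → ℝ => g k) n (stdNormal κ) :=
    (memLp_id_gaussianReal n).comp_measurePreserving (measurePreserving_eval _ k)
  have h_sum : MemLp (fun g : κ → ℝ => 1 + ∑ k, |g k|) n (stdNormal κ) :=
    (memLp_const (1 : ℝ)).add (memLp_finsetSum _ fun k _ => (h_eval k).abs)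
  refine h_sum.integrable_norm_pow'.mono' (by fun_prop) (ae_of_all _ fun g => ?_)
  have h_norm : ‖g‖ ≤ ∑ k, |g k| :=
    (pi_norm_le_iff_of_nonneg (by positivity)).2 fun k =>
      Finset.single_le_sum (f := fun k => |g k|) (fun _ _ => abs_nonneg _) (Finset.mem_univ k)
  rw [Real.norm_of_nonneg (by positivity), Real.norm_of_nonneg (by positivity)]
  gcongr

/-- `F x` is bounded by a polynomial in `‖p x‖`. For `p = id` such functions are integrable for
every measure with moments of all orders; for a projection `p` the bound is uniform in the other
coordinates. -/
def PolyGrowth {X E : Type*} [NormedAddCommGroup E] (p : X → E) (F : X → ℝ) : Prop :=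
  ∃ n : ℕ, F =O[⊤] fun x => (1 + ‖p x‖) ^ n

namespace PolyGrowth

variable {X E : Type*} [NormedAddCommGroup E] {p : X → E} {F G : X → ℝ}

lemma of_abs_le {C : ℝ} (hF : ∀ x, |F x| ≤ C) : PolyGrowth p F :=
  ⟨0, Asymptotics.IsBigO.of_bound C (Eventually.of_forall (by simpa using hF))⟩

lemma of_abs_le_mul_norm {C : ℝ} (hF : ∀ x, |F x| ≤ C * ‖p x‖) : PolyGrowth p F := by
  refine ⟨1, Asymptotics.IsBigO.of_bound |C| (Eventually.of_forall fun x => ?_)⟩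
  rw [pow_one, Real.norm_of_nonneg (by positivity : 0 ≤ 1 + ‖p x‖)]
  calc ‖F x‖ ≤ C * ‖p x‖ := hF x
    _ ≤ |C| * (1 + ‖p x‖) := by gcongr <;> linarith [le_abs_self C]

lemma isBigO_of_le {m n : ℕ} (hmn : m ≤ n) (hF : F =O[⊤] fun x => (1 + ‖p x‖) ^ m) :
    F =O[⊤] fun x => (1 + ‖p x‖) ^ n := by
  refine hF.trans (Asymptotics.IsBigO.of_bound 1 (Eventually.of_forall fun x => ?_))
  rw [one_mul, norm_pow, norm_pow]
  refine pow_le_pow_right₀ ?_ hmn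
  rw [Real.norm_of_nonneg (by positivity)]
  linarith [norm_nonneg (p x)]

lemma add (hF : PolyGrowth p F) (hG : PolyGrowth p G) : PolyGrowth p fun x => F x + G x := by
  obtain ⟨m, hm⟩ := hF
  obtain ⟨n, hn⟩ := hG
  exact ⟨max m n, (isBigO_of_le (le_max_left m n) hm).add (isBigO_of_le (le_max_right m n) hn)⟩

lemma neg (hF : PolyGrowth p F) : PolyGrowth p fun x => -F x :=
  hF.imp fun _ hn => hn.neg_left

lemma mul (hF : PolyGrowth p F) (hG : PolyGrowth p G) : PolyGrowth p fun x => F x * G x := by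
  obtain ⟨m, hm⟩ := hF
  obtain ⟨n, hn⟩ := hG
  exact ⟨m + n, by simpa only [pow_add] using hm.mul hn⟩

lemma sub (hF : PolyGrowth p F) (hG : PolyGrowth p G) : PolyGrowth p fun x => F x - G x := by
  simpa only [sub_eq_add_neg] using hF.add hG.neg

lemma comp {Y : Type*} (hF : PolyGrowth p F) (φ : Y → X) :
    PolyGrowth (fun y => p (φ y)) fun y => F (φ y) :=
  hF.imp fun _ hn => hn.comp_tendsto tendsto_top

lemma integrable_stdNormal {κ : Type*} [Fintype κ] {F : (κ → ℝ) → ℝ} (h : PolyGrowth id F)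
    (hF : Continuous F) : Integrable F (stdNormal κ) := by
  obtain ⟨n, hn⟩ := h
  obtain ⟨C, hC⟩ := hn.bound
  refine ((integrable_one_add_norm_pow_stdNormal n).const_mul C).mono' hF.aestronglyMeasurable
    (ae_of_all _ fun g => ?_)
  simpa [abs_of_nonneg (by positivity : 0 ≤ 1 + ‖g‖)] using Filter.eventually_top.1 hC g

end PolyGrowth

/-- Continuously differentiable functions which have polynomial growth together with their
directional derivatives: the class on which Gaussian integration by parts is performed. -/
structure HasC1PolyGrowth {E : Type*} [NormedAddCommGroup E] [NormedSpace ℝ E] (F : E → ℝ) :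
    Prop where
  contDiff : ContDiff ℝ 1 F
  polyGrowth : PolyGrowth id F
  polyGrowth_fderiv (v : E) : PolyGrowth id fun x => fderiv ℝ F x v

namespace HasC1PolyGrowth

variable {E : Type*} [NormedAddCommGroup E] [NormedSpace ℝ E] {F G : E → ℝ}

lemma differentiable (hF : HasC1PolyGrowth F) : Differentiable ℝ F :=
  hF.contDiff.differentiable one_ne_zero

lemma continuous_fderiv_apply (hF : HasC1PolyGrowth F) (v : E) :
    Continuous fun x => fderiv ℝ F x v :=
  (hF.contDiff.continuous_fderiv one_ne_zero).clm_apply continuous_const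

lemma sub (hF : HasC1PolyGrowth F) (hG : HasC1PolyGrowth G) :
    HasC1PolyGrowth fun x => F x - G x where
  contDiff := hF.contDiff.sub hG.contDiff
  polyGrowth := hF.polyGrowth.sub hG.polyGrowth
  polyGrowth_fderiv v := by
    simp only [fderiv_fun_sub (hF.differentiable _) (hG.differentiable _)]
    exact (hF.polyGrowth_fderiv v).sub (hG.polyGrowth_fderiv v)

lemma mul (hF : HasC1PolyGrowth F) (hG : HasC1PolyGrowth G) :
    HasC1PolyGrowth fun x => F x * G x where
  contDiff := hF.contDiff.mul hG.contDiff
  polyGrowth := hF.polyGrowth.mul hG.polyGrowth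
  polyGrowth_fderiv v := by
    simp only [fderiv_fun_mul (hF.differentiable _) (hG.differentiable _)]
    exact (hF.polyGrowth.mul (hG.polyGrowth_fderiv v)).add
      (hG.polyGrowth.mul (hF.polyGrowth_fderiv v))

lemma integrable_stdNormal {κ : Type*} [Fintype κ] {F : (κ → ℝ) → ℝ} (hF : HasC1PolyGrowth F) :
    Integrable F (stdNormal κ) :=
  hF.polyGrowth.integrable_stdNormal hF.contDiff.continuous

lemma integrable_fderiv_apply_stdNormal {κ : Type*} [Fintype κ] {F : (κ → ℝ) → ℝ}
    (hF : HasC1PolyGrowth F) (v : κ → ℝ) : Integrable (fun g => fderiv ℝ F g v) (stdNormal κ) :=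
  (hF.polyGrowth_fderiv v).integrable_stdNormal (hF.continuous_fderiv_apply v)

end HasC1PolyGrowth

section DotProduct

variable {κ : Type*} [Fintype κ]

lemma hasFDerivAt_dotProduct (v g : κ → ℝ) :
    HasFDerivAt (fun x => v ⬝ᵥ x) (dotProductBilin ℝ ℝ v).toContinuousLinearMap g :=
  (dotProductBilin ℝ ℝ v).toContinuousLinearMap.hasFDerivAt

lemma contDiff_dotProduct {n : WithTop ℕ∞} (v : κ → ℝ) : ContDiff ℝ n fun g => v ⬝ᵥ g :=
  (dotProductBilin ℝ ℝ v).toContinuousLinearMap.contDiff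

lemma hasC1PolyGrowth_dotProduct (v : κ → ℝ) : HasC1PolyGrowth fun g => v ⬝ᵥ g where
  contDiff := contDiff_dotProduct v
  polyGrowth := PolyGrowth.of_abs_le_mul_norm fun g =>
    (dotProductBilin ℝ ℝ v).toContinuousLinearMap.le_opNorm g
  polyGrowth_fderiv u := by
    simp only [(hasFDerivAt_dotProduct v _).fderiv]
    exact PolyGrowth.of_abs_le fun _ => le_rfl

end DotProduct

section SteinIdentity

lemma hasDerivAt_gaussianPDFReal_zero_one (x : ℝ) :
    HasDerivAt (gaussianPDFReal 0 1) (-x * gaussianPDFReal 0 1 x) x := by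
  have h_exponent : HasDerivAt (fun x : ℝ => -(x - 0) ^ 2 / (2 * ((1 : NNReal) : ℝ))) (-x) x := by
    refine ((((hasDerivAt_id' x).sub_const 0).fun_pow 2).fun_neg.div_const
      (2 * ((1 : NNReal) : ℝ))).congr_deriv ?_
    rw [NNReal.coe_one]
    ring
  rw [gaussianPDFReal_def]
  refine (h_exponent.exp.const_mul (√(2 * Real.pi * ((1 : NNReal) : ℝ)))⁻¹).congr_deriv ?_
  ring

lemma integral_id_mul_gaussianReal_eq_integral_deriv {f f' : ℝ → ℝ}
    (hf : ∀ x, HasDerivAt f (f' x) x) (hf_int : Integrable f (gaussianReal 0 1))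
    (hf'_int : Integrable f' (gaussianReal 0 1))
    (hxf_int : Integrable (fun x => x * f x) (gaussianReal 0 1)) :
    ∫ x, x * f x ∂gaussianReal 0 1 = ∫ x, f' x ∂gaussianReal 0 1 := by
  have h_density {h : ℝ → ℝ} (hh : Integrable h (gaussianReal 0 1)) :
      Integrable (fun x => h x * gaussianPDFReal 0 1 x) := by
    rw [gaussianReal_of_var_ne_zero 0 one_ne_zero, integrable_withDensity_iff_integrable_smul'
      (measurable_gaussianPDF 0 1) (ae_of_all _ fun x => gaussianPDF_lt_top)] at hh
    simpa [toReal_gaussianPDF, mul_comm] using hh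
  have h_parts := integral_mul_deriv_eq_deriv_mul_of_integrable (u := f) (u' := f')
    (v := gaussianPDFReal 0 1) (v' := fun x => -x * gaussianPDFReal 0 1 x)
    (fun x _ => hf x) (fun x _ => hasDerivAt_gaussianPDFReal_zero_one x)
    ((h_density hxf_int).neg.congr (ae_of_all _ fun x => by simp; ring))
    (h_density hf'_int) (h_density hf_int)
  simp only [integral_gaussianReal_eq_integral_smul one_ne_zero, smul_eq_mul]
  calc ∫ x, gaussianPDFReal 0 1 x * (x * f x)
      = -∫ x, f x * (-x * gaussianPDFReal 0 1 x) := by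
        rw [← integral_neg]; congr 1; ext x; ring
    _ = ∫ x, gaussianPDFReal 0 1 x * f' x := by
        rw [h_parts, neg_neg]; simp only [mul_comm]

variable {κ : Type*} [Fintype κ] {F : (κ → ℝ) → ℝ}

lemma HasC1PolyGrowth.integrable_eval_mul (hF : HasC1PolyGrowth F) (k : κ) :
    Integrable (fun g => g k * F g) (stdNormal κ) := by
  classical
  simpa using ((hasC1PolyGrowth_dotProduct (Pi.single k 1)).mul hF).integrable_stdNormal

lemma HasC1PolyGrowth.integral_eval_mul [DecidableEq κ] (hF : HasC1PolyGrowth F) (k : κ) :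
    ∫ g, g k * F g ∂stdNormal κ = ∫ g, fderiv ℝ F g (Pi.single k 1) ∂stdNormal κ := by
  have h_resample {G : (κ → ℝ) → ℝ} (hG : Integrable G (stdNormal κ)) :
      ∀ᵐ g ∂stdNormal κ, Integrable (fun x => G (Function.update g k x)) (gaussianReal 0 1) :=
    ((measurePreserving_update k).integrable_comp_of_integrable hG).prod_right_ae
  have hkF_int := hF.integrable_eval_mul k
  rw [integral_eq_integral_update k hkF_int,
    integral_eq_integral_update k (hF.integrable_fderiv_apply_stdNormal _)]
  refine integral_congr_ae ?_
  filter_upwards [h_resample hF.integrable_stdNormal,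
    h_resample (hF.integrable_fderiv_apply_stdNormal (Pi.single k 1)),
    h_resample hkF_int] with g h₀ h₁ h₂
  simp only [Function.update_self] at h₂ ⊢
  exact integral_id_mul_gaussianReal_eq_integral_deriv (fun x =>
    (hF.differentiable _).hasFDerivAt.comp_hasDerivAt x (hasDerivAt_update g k x)) h₀ h₁ h₂

lemma HasC1PolyGrowth.integral_dotProduct_mul (hF : HasC1PolyGrowth F) (v : κ → ℝ) :
    ∫ g, (v ⬝ᵥ g) * F g ∂stdNormal κ = ∫ g, fderiv ℝ F g v ∂stdNormal κ := by
  classical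
  have h_fderiv (g : κ → ℝ) : fderiv ℝ F g v = ∑ k, v k * fderiv ℝ F g (Pi.single k 1) := by
    conv_lhs => rw [pi_eq_sum_univ' v]
    simp
  simp only [h_fderiv, dotProduct, Finset.sum_mul, mul_assoc]
  rw [integral_finsetSum _ fun k _ => (hF.integrable_eval_mul k).const_mul _,
    integral_finsetSum _ fun k _ => (hF.integrable_fderiv_apply_stdNormal _).const_mul _]
  simp only [integral_const_mul, hF.integral_eval_mul]

lemma HasC1PolyGrowth.integral_dotProduct_mul_dotProduct_mul {F₁ F₂ : (κ → ℝ) → ℝ} {u v : κ → ℝ}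
    (hF₁ : HasC1PolyGrowth F₁) (hF₂ : HasC1PolyGrowth F₂)
    (hF₂' : HasC1PolyGrowth fun g => fderiv ℝ F₂ g v) (hv : ∀ g, fderiv ℝ F₁ g v = 0)
    (hu : ∀ g, fderiv ℝ (fun x => fderiv ℝ F₂ x v) g u = 0) :
    ∫ g, (v ⬝ᵥ g) * ((u ⬝ᵥ g) * (F₁ g * F₂ g)) ∂stdNormal κ
      = (u ⬝ᵥ v) * ∫ g, F₁ g * F₂ g ∂stdNormal κ
        + ∫ g, fderiv ℝ F₁ g u * fderiv ℝ F₂ g v ∂stdNormal κ := by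
  have h_lin := hasC1PolyGrowth_dotProduct u
  have h_prod := hF₁.mul hF₂
  have h_prod' := hF₁.mul hF₂'
  have h_first (g : κ → ℝ) : fderiv ℝ (fun g => (u ⬝ᵥ g) * (F₁ g * F₂ g)) g v
      = (u ⬝ᵥ v) * (F₁ g * F₂ g) + (u ⬝ᵥ g) * (F₁ g * fderiv ℝ F₂ g v) := by
    rw [fderiv_fun_mul (h_lin.differentiable g) (h_prod.differentiable g),
      fderiv_fun_mul (hF₁.differentiable g) (hF₂.differentiable g),
      (hasFDerivAt_dotProduct u g).fderiv]
    simp [hv]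
    ring
  have h_second (g : κ → ℝ) : fderiv ℝ (fun g => F₁ g * fderiv ℝ F₂ g v) g u
      = fderiv ℝ F₁ g u * fderiv ℝ F₂ g v := by
    rw [fderiv_fun_mul (hF₁.differentiable g) (hF₂'.differentiable g)]
    simp [hu, mul_comm]
  rw [(h_lin.mul h_prod).integral_dotProduct_mul v]
  simp only [h_first]
  rw [integral_add, integral_const_mul, h_prod'.integral_dotProduct_mul u]
  · simp only [h_second]
  · exact h_prod.integrable_stdNormal.const_mul _
  · exact (h_lin.mul h_prod').integrable_stdNormal

end SteinIdentity

/-- The Gibbs average of `f` for the weights `exp (w σ)`. -/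
def gibbs {S : Type*} [Fintype S] (w f : S → ℝ) : ℝ :=
  (∑ σ, f σ * Real.exp (w σ)) / ∑ σ, Real.exp (w σ)

/-- The truncated correlation of `f` and `h` for the weights `exp (w σ)`. -/
def gibbsCov {S : Type*} [Fintype S] (w f h : S → ℝ) : ℝ :=
  gibbs w (fun σ => f σ * h σ) - gibbs w f * gibbs w h

/-- The pressure, i.e. the logarithm of the partition function, for the weights `exp (w σ)`. -/
def pressure {S : Type*} [Fintype S] (w : S → ℝ) : ℝ := Real.log (∑ σ, Real.exp (w σ))

section Gibbs

variable {S : Type*} [Fintype S]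

lemma gibbs_add (w f h : S → ℝ) : gibbs w (fun σ => f σ + h σ) = gibbs w f + gibbs w h := by
  simp only [gibbs, add_mul, Finset.sum_add_distrib, add_div]

lemma gibbs_const_mul (w f : S → ℝ) (c : ℝ) : gibbs w (fun σ => c * f σ) = c * gibbs w f := by
  simp only [gibbs, mul_assoc, ← Finset.mul_sum, mul_div_assoc]

lemma gibbs_sum {ι : Type*} (s : Finset ι) (w : S → ℝ) (f : ι → S → ℝ) :
    gibbs w (fun σ => ∑ i ∈ s, f i σ) = ∑ i ∈ s, gibbs w (f i) := by
  simp only [gibbs, Finset.sum_mul, Finset.sum_div]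
  rw [Finset.sum_comm]

lemma gibbsCov_const_mul (w f h : S → ℝ) (c : ℝ) :
    gibbsCov w f (fun σ => c * h σ) = c * gibbsCov w f h := by
  simp only [gibbsCov, mul_left_comm _ c, gibbs_const_mul, mul_sub]

lemma gibbsCov_zero (w f : S → ℝ) : gibbsCov w f (fun _ => 0) = 0 := by
  simpa using gibbsCov_const_mul w f 0 0

lemma gibbsCov_comm (w f h : S → ℝ) : gibbsCov w f h = gibbsCov w h f := by
  simp only [gibbsCov, mul_comm]

variable [Nonempty S]

lemma sum_exp_pos (w : S → ℝ) : 0 < ∑ σ, Real.exp (w σ) :=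
  Finset.sum_pos (fun _ _ => Real.exp_pos _) Finset.univ_nonempty

lemma gibbs_const (w : S → ℝ) (c : ℝ) : gibbs w (fun _ => c) = c := by
  rw [gibbs, ← Finset.mul_sum, mul_div_cancel_right₀ _ (sum_exp_pos w).ne']

lemma gibbs_mono (w : S → ℝ) {f h : S → ℝ} (hfh : ∀ σ, f σ ≤ h σ) : gibbs w f ≤ gibbs w h := by
  unfold gibbs
  gcongr with σ
  exact hfh σ

lemma abs_gibbs_le (w : S → ℝ) {f : S → ℝ} {C : ℝ} (hC : ∀ σ, |f σ| ≤ C) : |gibbs w f| ≤ C := by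
  rw [abs_le, ← gibbs_const w (-C)]
  refine ⟨gibbs_mono w fun σ => (abs_le.1 (hC σ)).1, ?_⟩
  exact (gibbs_mono w fun σ => (abs_le.1 (hC σ)).2).trans_eq (gibbs_const w C)

lemma abs_gibbs_le_sum (w f : S → ℝ) : |gibbs w f| ≤ ∑ σ, |f σ| :=
  abs_gibbs_le w fun σ =>
    Finset.single_le_sum (f := fun σ => |f σ|) (fun _ _ => abs_nonneg _) (Finset.mem_univ σ)

lemma pressure_add_gibbs_le (w h : S → ℝ) :
    pressure w + gibbs w h ≤ pressure fun σ => w σ + h σ := by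
  set c := gibbs w h with hc
  have h_jensen : 1 ≤ gibbs w fun σ => Real.exp (h σ - c) := by
    have h_mono : gibbs w (fun σ => h σ + (-c + 1)) ≤ gibbs w fun σ => Real.exp (h σ - c) :=
      gibbs_mono w fun σ => by linarith [Real.add_one_le_exp (h σ - c)]
    rwa [gibbs_add, gibbs_const, ← hc, add_neg_cancel_left] at h_mono
  rw [gibbs, one_le_div (sum_exp_pos w)] at h_jensen
  have h_tilt : (∑ σ, Real.exp (w σ)) * Real.exp c ≤ ∑ σ, Real.exp (w σ + h σ) := by
    calc (∑ σ, Real.exp (w σ)) * Real.exp c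
        ≤ (∑ σ, Real.exp (h σ - c) * Real.exp (w σ)) * Real.exp c := by gcongr
      _ = ∑ σ, Real.exp (w σ + h σ) := by
        simp only [Finset.sum_mul, ← Real.exp_add]
        congr! 2
        ring
  have h_log := Real.log_le_log (mul_pos (sum_exp_pos w) (Real.exp_pos c)) h_tilt
  rwa [Real.log_mul (sum_exp_pos w).ne' (Real.exp_pos c).ne', Real.log_exp] at h_log

lemma abs_pressure_sub_le {w w' : S → ℝ} {C : ℝ} (hC : ∀ σ, |w σ - w' σ| ≤ C) :
    |pressure w - pressure w'| ≤ C := by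
  have h_le {w w' : S → ℝ} (hC : ∀ σ, |w σ - w' σ| ≤ C) : pressure w' - pressure w ≤ C := by
    have h_tangent := pressure_add_gibbs_le w' fun σ => w σ - w' σ
    simp only [add_sub_cancel] at h_tangent
    linarith [neg_le_of_abs_le (abs_gibbs_le w' hC)]
  exact abs_sub_le_iff.2 ⟨h_le fun σ => abs_sub_comm (w σ) (w' σ) ▸ hC σ, h_le hC⟩

lemma continuous_gibbs {E : Type*} [TopologicalSpace E] {w f : E → S → ℝ}
    (hw : ∀ σ, Continuous fun x => w x σ) (hf : ∀ σ, Continuous fun x => f x σ) :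
    Continuous fun x => gibbs (w x) (f x) :=
  (continuous_finsetSum _ fun σ _ => (hf σ).mul (hw σ).rexp).div
    (continuous_finsetSum _ fun σ _ => (hw σ).rexp) fun x => (sum_exp_pos (w x)).ne'

lemma hasDerivAt_sum_mul_exp {S : Type*} [Fintype S] {w : ℝ → S → ℝ} {w' : S → ℝ} {t : ℝ}
    (hw : ∀ σ, HasDerivAt (fun x => w x σ) (w' σ) t) (f : S → ℝ) :
    HasDerivAt (fun x => ∑ σ, f σ * Real.exp (w x σ)) (∑ σ, f σ * w' σ * Real.exp (w t σ)) t :=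
  HasDerivAt.fun_sum fun σ _ => ((hw σ).exp.const_mul (f σ)).congr_deriv (by ring)

lemma hasDerivAt_pressure {w : ℝ → S → ℝ} {w' : S → ℝ} {t : ℝ}
    (hw : ∀ σ, HasDerivAt (fun x => w x σ) (w' σ) t) :
    HasDerivAt (fun x => pressure (w x)) (gibbs (w t) w') t := by
  have h_sum := hasDerivAt_sum_mul_exp hw 1
  simp only [Pi.one_apply, one_mul] at h_sum
  exact h_sum.log (sum_exp_pos (w t)).ne'

lemma hasDerivAt_gibbs {w : ℝ → S → ℝ} {w' : S → ℝ} {t : ℝ}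
    (hw : ∀ σ, HasDerivAt (fun x => w x σ) (w' σ) t) (f : S → ℝ) :
    HasDerivAt (fun x => gibbs (w x) f) (gibbsCov (w t) f w') t := by
  have h_sum := hasDerivAt_sum_mul_exp hw 1
  simp only [Pi.one_apply, one_mul] at h_sum
  have hZ := (sum_exp_pos (w t)).ne'
  refine ((hasDerivAt_sum_mul_exp hw f).fun_div h_sum hZ).congr_deriv ?_
  simp only [gibbsCov, gibbs]
  field_simp

section Affine

variable {κ : Type*} [Fintype κ] (a : S → ℝ) (A : S → κ → ℝ) (f : S → ℝ)

lemma contDiff_gibbs_affine {n : WithTop ℕ∞} :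
    ContDiff ℝ n fun g => gibbs (fun σ => a σ + A σ ⬝ᵥ g) f := by
  have h_exp (σ : S) : ContDiff ℝ n fun g => Real.exp (a σ + A σ ⬝ᵥ g) :=
    (contDiff_const.add (contDiff_dotProduct _)).exp
  exact (ContDiff.sum fun σ _ => contDiff_const.mul (h_exp σ)).div
    (ContDiff.sum fun σ _ => h_exp σ) fun g => (sum_exp_pos _).ne'

lemma fderiv_gibbs_affine (g v : κ → ℝ) :
    fderiv ℝ (fun g => gibbs (fun σ => a σ + A σ ⬝ᵥ g) f) g v
      = gibbsCov (fun σ => a σ + A σ ⬝ᵥ g) f fun σ => A σ ⬝ᵥ v := by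
  have h_exponent (σ : S) :
      HasDerivAt (fun t : ℝ => a σ + A σ ⬝ᵥ (g + t • v)) (A σ ⬝ᵥ v) 0 :=
    (hasFDerivAt_dotProduct (A σ) g).hasLineDerivAt v |>.const_add (a σ)
  have h_line : HasLineDerivAt ℝ (fun g => gibbs (fun σ => a σ + A σ ⬝ᵥ g) f)
      (gibbsCov (fun σ => a σ + A σ ⬝ᵥ g) f fun σ => A σ ⬝ᵥ v) g v := by
    simpa [HasLineDerivAt] using hasDerivAt_gibbs h_exponent f
  rw [← ((contDiff_gibbs_affine a A f).differentiable one_ne_zero g).lineDeriv_eq_fderiv,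
    h_line.lineDeriv]

lemma hasC1PolyGrowth_gibbs_affine :
    HasC1PolyGrowth fun g => gibbs (fun σ => a σ + A σ ⬝ᵥ g) f where
  contDiff := contDiff_gibbs_affine a A f
  polyGrowth := PolyGrowth.of_abs_le fun _ => abs_gibbs_le_sum _ _
  polyGrowth_fderiv v := by
    simp only [fderiv_gibbs_affine, gibbsCov]
    have h_bound (h : S → ℝ) : PolyGrowth id fun g => gibbs (fun σ => a σ + A σ ⬝ᵥ g) h :=
      PolyGrowth.of_abs_le fun _ => abs_gibbs_le_sum _ _
    exact (h_bound _).sub ((h_bound _).mul (h_bound _))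

lemma integral_dotProduct_mul_gibbs_eq_zero (v : κ → ℝ) (hv : ∀ σ, A σ ⬝ᵥ v = 0) :
    ∫ g, (v ⬝ᵥ g) * gibbs (fun σ => a σ + A σ ⬝ᵥ g) f ∂stdNormal κ = 0 := by
  rw [(hasC1PolyGrowth_gibbs_affine a A f).integral_dotProduct_mul]
  simp only [fderiv_gibbs_affine, hv, gibbsCov_zero, integral_zero]

lemma integral_dotProduct_mul_dotProduct_mul_gibbs (a₁ a₂ : S → ℝ) (A₁ A₂ : S → κ → ℝ)
    (f h : S → ℝ) (u v : κ → ℝ) (hv : ∀ σ, A₁ σ ⬝ᵥ v = 0) (hu : ∀ σ, A₂ σ ⬝ᵥ u = 0) :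
    ∫ g, (v ⬝ᵥ g) * ((u ⬝ᵥ g) * (gibbs (fun σ => a₁ σ + A₁ σ ⬝ᵥ g) f
        * gibbs (fun σ => a₂ σ + A₂ σ ⬝ᵥ g) h)) ∂stdNormal κ
      = (u ⬝ᵥ v) * ∫ g, gibbs (fun σ => a₁ σ + A₁ σ ⬝ᵥ g) f
          * gibbs (fun σ => a₂ σ + A₂ σ ⬝ᵥ g) h ∂stdNormal κ
        + ∫ g, gibbsCov (fun σ => a₁ σ + A₁ σ ⬝ᵥ g) f (fun σ => A₁ σ ⬝ᵥ u)
          * gibbsCov (fun σ => a₂ σ + A₂ σ ⬝ᵥ g) h (fun σ => A₂ σ ⬝ᵥ v) ∂stdNormal κ := by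
  have hF (f : S → ℝ) := hasC1PolyGrowth_gibbs_affine a₂ A₂ f
  have hF' : HasC1PolyGrowth fun g =>
      gibbsCov (fun σ => a₂ σ + A₂ σ ⬝ᵥ g) h fun σ => A₂ σ ⬝ᵥ v :=
    (hF _).sub ((hF h).mul (hF _))
  have hF'_blind (g : κ → ℝ) : fderiv ℝ (fun g =>
      gibbsCov (fun σ => a₂ σ + A₂ σ ⬝ᵥ g) h fun σ => A₂ σ ⬝ᵥ v) g u = 0 := by
    unfold gibbsCov
    rw [fderiv_fun_sub ((hF _).differentiable g) (((hF _).mul (hF _)).differentiable g),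
      fderiv_fun_mul ((hF _).differentiable g) ((hF _).differentiable g)]
    simp [fderiv_gibbs_affine, hu, gibbsCov_zero]
  simp only [← fderiv_gibbs_affine] at hF' hF'_blind ⊢
  exact (hasC1PolyGrowth_gibbs_affine a₁ A₁ f).integral_dotProduct_mul_dotProduct_mul (hF h) hF'
    (fun g => by simp only [fderiv_gibbs_affine, hv, gibbsCov_zero]) hF'_blind

end Affine

end Gibbs

section IntervalIntegral

lemma continuous_intervalIntegral {E : Type*} [TopologicalSpace E] {f : ℝ → E → ℝ}
    (hf : Continuous (Function.uncurry f)) (a b : ℝ) :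
    Continuous fun x => ∫ t in a..b, f t x :=
  intervalIntegral.continuous_parametric_intervalIntegral_of_continuous'
    (f := fun x t => f t x) (hf.comp continuous_swap) a b

lemma abs_intervalIntegral_le {f : ℝ → ℝ} {C : ℝ} (hC : ∀ t, |f t| ≤ C) {a b : ℝ} (hab : a ≤ b) :
    |∫ t in a..b, f t| ≤ C * (b - a) := by
  simpa [abs_of_nonneg (sub_nonneg.2 hab)] using
    intervalIntegral.norm_integral_le_of_norm_le_const (a := a) (b := b) (f := f) fun x _ => hC x

lemma sq_intervalIntegral_le {f : ℝ → ℝ} (hf : Continuous f) {a b : ℝ} (hab : a ≤ b) :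
    (∫ t in a..b, f t) ^ 2 ≤ (b - a) * ∫ t in a..b, f t ^ 2 := by
  rcases hab.eq_or_lt with rfl | hlt
  · simp
  set I := ∫ t in a..b, f t with hI
  have h_nonneg : 0 ≤ ∫ t in a..b, ((b - a) * f t - I) ^ 2 :=
    intervalIntegral.integral_nonneg hab fun _ _ => sq_nonneg _
  have h_expand : ∫ t in a..b, ((b - a) * f t - I) ^ 2
      = (b - a) * ((b - a) * (∫ t in a..b, f t ^ 2) - I ^ 2) := by
    have h_sq (t : ℝ) : ((b - a) * f t - I) ^ 2
        = (b - a) ^ 2 * f t ^ 2 - 2 * (b - a) * I * f t + I ^ 2 := by ring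
    simp only [h_sq]
    rw [intervalIntegral.integral_add, intervalIntegral.integral_sub,
      intervalIntegral.integral_const_mul, intervalIntegral.integral_const_mul,
      intervalIntegral.integral_const, smul_eq_mul, ← hI]
    · ring
    all_goals exact Continuous.intervalIntegrable (by fun_prop) _ _
  rw [h_expand] at h_nonneg
  exact sub_nonneg.1 (nonneg_of_mul_nonneg_right h_nonneg (sub_pos.2 hlt))

lemma intervalIntegral_swap_of_continuous {f : ℝ → ℝ → ℝ} (hf : Continuous (Function.uncurry f))
    (a b c d : ℝ) : ∫ x in a..b, ∫ y in c..d, f x y = ∫ y in c..d, ∫ x in a..b, f x y :=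
  intervalIntegral_intervalIntegral_swap <|
    (hf.continuousOn.integrableOn_compact (isCompact_uIcc.prod isCompact_uIcc)).mono_set
      (Set.prod_mono Set.uIoc_subset_uIcc Set.uIoc_subset_uIcc)

lemma intervalIntegral_intervalIntegral_sub {f h : ℝ → ℝ → ℝ}
    (hf : Continuous (Function.uncurry f)) (hh : Continuous (Function.uncurry h)) (a b c d : ℝ) :
    ∫ x in a..b, ∫ y in c..d, (f x y - h x y)
      = (∫ x in a..b, ∫ y in c..d, f x y) - ∫ x in a..b, ∫ y in c..d, h x y := by
  have h_inner {f : ℝ → ℝ → ℝ} (hf : Continuous (Function.uncurry f)) :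
      IntervalIntegrable (fun x => ∫ y in c..d, f x y) volume a b :=
    (continuous_intervalIntegral (f := fun y x => f x y) (hf.comp continuous_swap)
      c d).intervalIntegrable a b
  rw [← intervalIntegral.integral_sub (h_inner hf) (h_inner hh)]
  refine intervalIntegral.integral_congr fun x _ => ?_
  exact intervalIntegral.integral_sub ((hf.uncurry_left x).intervalIntegrable c d)
    ((hh.uncurry_left x).intervalIntegrable c d)

lemma intervalIntegral_intervalIntegral_eq_zero_of_antisymm {f : ℝ → ℝ → ℝ}
    (hf : Continuous (Function.uncurry f)) (h_antisymm : ∀ x y, f y x = -f x y) (a b : ℝ) :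
    ∫ x in a..b, ∫ y in a..b, f x y = 0 := by
  have h_eq_neg : ∫ x in a..b, ∫ y in a..b, f x y = -∫ x in a..b, ∫ y in a..b, f x y := calc
    _ = ∫ y in a..b, ∫ x in a..b, f x y := intervalIntegral_swap_of_continuous hf a b a b
    _ = ∫ y in a..b, ∫ x in a..b, -f y x := by simp only [← h_antisymm]
    _ = _ := by simp only [intervalIntegral.integral_neg]
  linarith

end IntervalIntegral

/-- Jointly continuous families of functions of Gaussian variables which are bounded by a
polynomial, uniformly in the parameter; this is what makes Fubini and dominated convergence
apply. -/
structure UniformPolyGrowth {Y κ : Type*} [TopologicalSpace Y] [Fintype κ]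
    (F : Y → (κ → ℝ) → ℝ) : Prop where
  continuous : Continuous (Function.uncurry F)
  polyGrowth : PolyGrowth Prod.snd (Function.uncurry F)

namespace UniformPolyGrowth

variable {Y κ : Type*} [TopologicalSpace Y] [Fintype κ] {F G : Y → (κ → ℝ) → ℝ}

lemma of_abs_le {C : ℝ} (hF : Continuous (Function.uncurry F)) (hC : ∀ y g, |F y g| ≤ C) :
    UniformPolyGrowth F :=
  ⟨hF, PolyGrowth.of_abs_le fun x => hC x.1 x.2⟩

lemma eval (k : κ) : UniformPolyGrowth fun (_ : Y) (g : κ → ℝ) => g k where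
  continuous := (continuous_apply k).comp continuous_snd
  polyGrowth := PolyGrowth.of_abs_le_mul_norm (C := 1) fun x =>
    (norm_le_pi_norm x.2 k).trans_eq (one_mul _).symm

lemma add (hF : UniformPolyGrowth F) (hG : UniformPolyGrowth G) :
    UniformPolyGrowth fun y g => F y g + G y g :=
  ⟨hF.continuous.add hG.continuous, hF.polyGrowth.add hG.polyGrowth⟩

lemma sub (hF : UniformPolyGrowth F) (hG : UniformPolyGrowth G) :
    UniformPolyGrowth fun y g => F y g - G y g :=
  ⟨hF.continuous.sub hG.continuous, hF.polyGrowth.sub hG.polyGrowth⟩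

lemma mul (hF : UniformPolyGrowth F) (hG : UniformPolyGrowth G) :
    UniformPolyGrowth fun y g => F y g * G y g :=
  ⟨hF.continuous.mul hG.continuous, hF.polyGrowth.mul hG.polyGrowth⟩

lemma const (c : ℝ) : UniformPolyGrowth fun (_ : Y) (_ : κ → ℝ) => c :=
  of_abs_le continuous_const fun _ _ => le_rfl

lemma const_mul (c : ℝ) (hF : UniformPolyGrowth F) : UniformPolyGrowth fun y g => c * F y g :=
  (const c).mul hF

lemma sum {ι : Type*} (s : Finset ι) {F : ι → Y → (κ → ℝ) → ℝ}
    (hF : ∀ i ∈ s, UniformPolyGrowth (F i)) : UniformPolyGrowth fun y g => ∑ i ∈ s, F i y g := by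
  classical
  induction s using Finset.induction_on with
  | empty => simpa using const 0
  | insert i s hi ih =>
    simp only [Finset.sum_insert hi]
    exact (hF i (Finset.mem_insert_self i s)).add
      (ih fun j hj => hF j (Finset.mem_insert_of_mem hj))

lemma comp {Z : Type*} [TopologicalSpace Z] (hF : UniformPolyGrowth F) {φ : Z → Y}
    (hφ : Continuous φ) : UniformPolyGrowth fun z => F (φ z) where
  continuous := hF.continuous.comp (hφ.prodMap continuous_id)
  polyGrowth := hF.polyGrowth.comp (Prod.map φ id)

lemma integrable (hF : UniformPolyGrowth F) (y : Y) : Integrable (F y) (stdNormal κ) :=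
  (hF.polyGrowth.comp fun g => (y, g)).integrable_stdNormal (hF.continuous.uncurry_left y)

lemma memLp_two (hF : UniformPolyGrowth F) (y : Y) : MemLp (F y) 2 (stdNormal κ) := by
  refine (memLp_two_iff_integrable_sq (hF.continuous.uncurry_left y).aestronglyMeasurable).2 ?_
  simpa only [sq] using (hF.mul hF).integrable y

lemma exists_integrable_bound (hF : UniformPolyGrowth F) :
    ∃ bound : (κ → ℝ) → ℝ, Integrable bound (stdNormal κ) ∧ ∀ y g, |F y g| ≤ bound g := by
  obtain ⟨n, hn⟩ := hF.polyGrowth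
  obtain ⟨C, hC⟩ := hn.bound
  refine ⟨_, (integrable_one_add_norm_pow_stdNormal n).const_mul C, fun y g => ?_⟩
  simpa [abs_of_nonneg (by positivity : 0 ≤ 1 + ‖g‖)] using Filter.eventually_top.1 hC (y, g)

lemma continuous_integral [FirstCountableTopology Y] (hF : UniformPolyGrowth F) :
    Continuous fun y => ∫ g, F y g ∂stdNormal κ := by
  obtain ⟨bound, h_int, h_bound⟩ := hF.exists_integrable_bound
  exact continuous_of_dominated (fun y => (hF.continuous.uncurry_left y).aestronglyMeasurable)
    (fun y => ae_of_all _ (h_bound y)) h_int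
    (ae_of_all _ fun g => hF.continuous.uncurry_right g)

lemma integral_const [FirstCountableTopology Y] (hF : UniformPolyGrowth F) :
    UniformPolyGrowth fun y (_ : κ → ℝ) => ∫ g, F y g ∂stdNormal κ := by
  obtain ⟨bound, h_int, h_bound⟩ := hF.exists_integrable_bound
  exact of_abs_le (C := ∫ g, bound g ∂stdNormal κ) (hF.continuous_integral.comp continuous_fst)
    fun y _ => norm_integral_le_of_norm_le (f := F y) h_int (ae_of_all _ (h_bound y))

lemma continuous_variance [FirstCountableTopology Y] (hF : UniformPolyGrowth F) :
    Continuous fun y => Var[F y; stdNormal κ] := by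
  simp_rw [fun y => variance_eq_sub (hF.memLp_two y), Pi.pow_apply, sq]
  exact (hF.mul hF).continuous_integral.sub (hF.continuous_integral.mul hF.continuous_integral)

section Interval

variable {F : ℝ → (κ → ℝ) → ℝ}

lemma intervalIntegral (hF : UniformPolyGrowth F) (a b : ℝ) :
    UniformPolyGrowth fun (_ : Y) g => ∫ t in a..b, F t g where
  continuous := (continuous_intervalIntegral hF.continuous a b).comp continuous_snd
  polyGrowth := by
    obtain ⟨n, hn⟩ := hF.polyGrowth
    obtain ⟨C, hC⟩ := hn.bound
    refine ⟨n, Asymptotics.IsBigO.of_bound (C * |b - a|) (Eventually.of_forall fun x => ?_)⟩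
    rw [mul_right_comm]
    exact intervalIntegral.norm_integral_le_of_norm_le_const fun t _ =>
      Filter.eventually_top.1 hC (t, x.2)

lemma integral_intervalIntegral (hF : UniformPolyGrowth F) (a b : ℝ) :
    ∫ g, (∫ t in a..b, F t g) ∂stdNormal κ = ∫ t in a..b, ∫ g, F t g ∂stdNormal κ := by
  obtain ⟨bound, h_int, h_bound⟩ := hF.exists_integrable_bound
  have : IsFiniteMeasure (volume.restrict (Set.uIoc a b)) := ⟨by simp [Set.uIoc]⟩
  exact (intervalIntegral_integral_swap ((h_int.comp_snd _).mono'
    hF.continuous.aestronglyMeasurable (ae_of_all _ fun p => h_bound p.1 p.2))).symm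

lemma integral_sq_intervalIntegral (hF : UniformPolyGrowth F) (a b : ℝ) :
    ∫ g, (∫ t in a..b, F t g) ^ 2 ∂stdNormal κ
      = ∫ t in a..b, ∫ s in a..b, ∫ g, F t g * F s g ∂stdNormal κ := by
  have h_outer := (hF.mul (hF.intervalIntegral a b)).integral_intervalIntegral a b
  simp only [intervalIntegral.integral_mul_const, ← sq] at h_outer
  rw [h_outer]
  refine intervalIntegral.integral_congr fun t _ => ?_
  have h_inner := ((hF.comp (continuous_const (y := t))).mul hF).integral_intervalIntegral a b
  simpa only [intervalIntegral.integral_const_mul] using h_inner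

lemma variance_intervalIntegral_le (hF : UniformPolyGrowth F) {a b : ℝ} (hab : a ≤ b) :
    Var[fun g => ∫ t in a..b, F t g; stdNormal κ]
      ≤ (b - a) * ∫ t in a..b, Var[F t; stdNormal κ] := by
  have h_dev := hF.sub hF.integral_const
  have h_var (t : ℝ) : Var[F t; stdNormal κ]
      = ∫ g, (F t g - ∫ g', F t g' ∂stdNormal κ) * (F t g - ∫ g', F t g' ∂stdNormal κ)
        ∂stdNormal κ := by
    simp only [variance_eq_integral (hF.memLp_two t).aemeasurable, sq]
  have h_center (g : κ → ℝ) : (∫ t in a..b, F t g) - ∫ g', (∫ t in a..b, F t g') ∂stdNormal κ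
      = ∫ t in a..b, (F t g - ∫ g', F t g' ∂stdNormal κ) := by
    rw [hF.integral_intervalIntegral, intervalIntegral.integral_sub
      ((hF.continuous.uncurry_right g).intervalIntegrable a b)
      (hF.continuous_integral.intervalIntegrable a b)]
  have h_sq := h_dev.mul h_dev
  rw [variance_eq_integral ((hF.intervalIntegral (Y := Unit) a b).memLp_two ()).aemeasurable]
  simp only [h_center, h_var]
  rw [← h_sq.integral_intervalIntegral, ← integral_const_mul]
  refine integral_mono ?_ (((h_sq.intervalIntegral (Y := Unit) a b).integrable ()).const_mul _)
    fun g => ?_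
  · simpa only [sq] using
      ((h_dev.intervalIntegral a b).mul (h_dev.intervalIntegral (Y := Unit) a b)).integrable ()
  · simpa only [sq] using sq_intervalIntegral_le (h_dev.continuous.uncurry_right g) hab

end Interval

end UniformPolyGrowth

section Subgradient

lemma abs_integral_add_sub_le {q : ℝ → ℝ} {C : ℝ} (hq : Monotone q) (hC : ∀ x, |q x| ≤ C)
    {δ : ℝ} (hδ : 0 ≤ δ) (a b : ℝ) : |∫ x in a..b, (q (x + δ) - q x)| ≤ 2 * C * δ := by
  have h_int (x y : ℝ) : IntervalIntegrable q volume x y := hq.intervalIntegrable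
  have h_telescope : ∫ x in a..b, (q (x + δ) - q x)
      = (∫ x in b..(b + δ), q x) - ∫ x in a..(a + δ), q x := by
    have h_shift : IntervalIntegrable (fun x => q (x + δ)) volume a b :=
      (hq.comp fun _ _ h => add_le_add_left h δ).intervalIntegrable
    rw [intervalIntegral.integral_sub h_shift (h_int a b),
      intervalIntegral.integral_comp_add_right,
      intervalIntegral.integral_interval_sub_interval_comm' (h_int _ _) (h_int _ _) (h_int _ _)]
  have h_right := abs_intervalIntegral_le hC (le_add_of_nonneg_right hδ : b ≤ b + δ)
  have h_left := abs_intervalIntegral_le hC (le_add_of_nonneg_right hδ : a ≤ a + δ)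
  rw [add_sub_cancel_left] at h_left h_right
  rw [h_telescope]
  linarith [abs_sub (∫ x in b..(b + δ), q x) (∫ x in a..(a + δ), q x)]

lemma sq_sub_slope_le {p q : ℝ → ℝ} {C : ℝ} (h_slope : ∀ x y, p x + (y - x) * q x ≤ p y)
    (hC : ∀ x, |q x| ≤ C) (x : ℝ) {δ : ℝ} (hδ : 0 < δ) :
    (q x - δ⁻¹ * (p (x + δ) - p x)) ^ 2 ≤ 2 * C * (q (x + δ) - q x) := by
  set D := δ⁻¹ * (p (x + δ) - p x) - q x with hD
  have h_lower : 0 ≤ D := by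
    rw [hD, sub_nonneg, inv_mul_eq_div, le_div_iff₀ hδ]
    linarith [h_slope x (x + δ)]
  have h_upper : D ≤ q (x + δ) - q x := by
    rw [hD, sub_le_sub_iff_right, inv_mul_eq_div, div_le_iff₀ hδ]
    linarith [h_slope (x + δ) x]
  have h_le : D ≤ 2 * C := by
    linarith [(abs_le.1 (hC x)).1, (abs_le.1 (hC (x + δ))).2]
  calc (q x - δ⁻¹ * (p (x + δ) - p x)) ^ 2 = D * D := by rw [hD]; ring
    _ ≤ 2 * C * (q (x + δ) - q x) := mul_le_mul h_le h_upper h_lower (h_lower.trans h_le)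

variable {Ω : Type*} [MeasurableSpace Ω] {P : Measure Ω} [IsProbabilityMeasure P]
  {p q : ℝ → Ω → ℝ} {C V : ℝ}

lemma variance_subgradient_le (hp : ∀ x, MemLp (p x) 2 P)
    (hq : ∀ x, AEStronglyMeasurable (q x) P) (hC : ∀ x ω, |q x ω| ≤ C)
    (h_slope : ∀ ω x y, p x ω + (y - x) * q x ω ≤ p y ω) (hV : ∀ x, Var[p x; P] ≤ V)
    (x : ℝ) {δ : ℝ} (hδ : 0 < δ) :
    Var[q x; P] ≤ 8 * V / δ ^ 2 + 4 * C * ((∫ ω, q (x + δ) ω ∂P) - ∫ ω, q x ω ∂P) := by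
  have hq_memLp (x : ℝ) : MemLp (q x) 2 P := MemLp.of_bound (hq x) C (ae_of_all _ (hC x))
  have hq_int (x : ℝ) : Integrable (q x) P := (hq_memLp x).integrable one_le_two
  have h_split := variance_le_variance_add_integral_sq (hq_memLp x)
    (((hp (x + δ)).sub (hp x)).const_mul δ⁻¹)
  have h_slope_var : Var[fun ω => δ⁻¹ * (p (x + δ) - p x) ω; P] ≤ 4 * V / δ ^ 2 := by
    rw [variance_const_mul, inv_pow, inv_mul_eq_div]
    gcongr
    have h_diff : Var[p (x + δ) - p x; P] ≤ _ := variance_fun_sub_le (hp (x + δ)) (hp x)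
    linarith [hV x, hV (x + δ)]
  have h_sq : ∫ ω, (q x ω - δ⁻¹ * (p (x + δ) - p x) ω) ^ 2 ∂P
      ≤ 2 * C * ((∫ ω, q (x + δ) ω ∂P) - ∫ ω, q x ω ∂P) := by
    rw [← integral_sub (hq_int _) (hq_int _), ← integral_const_mul]
    exact integral_mono_of_nonneg (ae_of_all _ fun _ => sq_nonneg _)
      (((hq_int _).sub (hq_int _)).const_mul _)
      (ae_of_all _ fun ω => sq_sub_slope_le (h_slope ω) (fun x => hC x ω) x hδ)
  calc Var[q x; P] ≤ 2 * (4 * V / δ ^ 2)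
        + 2 * (2 * C * ((∫ ω, q (x + δ) ω ∂P) - ∫ ω, q x ω ∂P)) := by linarith
    _ = _ := by ring

lemma integral_variance_subgradient_le (hp : ∀ x, MemLp (p x) 2 P)
    (hq : ∀ x, AEStronglyMeasurable (q x) P) (hC : ∀ x ω, |q x ω| ≤ C)
    (h_slope : ∀ ω x y, p x ω + (y - x) * q x ω ≤ p y ω) (hV : ∀ x, Var[p x; P] ≤ V)
    {a b : ℝ} (hab : a ≤ b) (h_var : IntervalIntegrable (fun x => Var[q x; P]) volume a b)
    {δ : ℝ} (hδ : 0 < δ) :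
    ∫ x in a..b, Var[q x; P] ≤ 8 * V / δ ^ 2 * (b - a) + 8 * C ^ 2 * δ := by
  set e : ℝ → ℝ := fun x => ∫ ω, q x ω ∂P
  have hq_int (x : ℝ) : Integrable (q x) P :=
    (MemLp.of_bound (hq x) C (ae_of_all _ (hC x))).integrable le_rfl
  have he_mono : Monotone e := fun x y hxy => integral_mono (hq_int x) (hq_int y) fun ω => by
    rcases hxy.eq_or_lt with rfl | hlt
    · rfl
    · nlinarith [h_slope ω x y, h_slope ω y x]
  have he_abs (x : ℝ) : |e x| ≤ C := by
    simpa using norm_integral_le_of_norm_le_const (f := q x) (ae_of_all P (hC x))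
  have hC_nonneg : 0 ≤ C := (abs_nonneg _).trans (he_abs 0)
  have h_incr : IntervalIntegrable (fun x => e (x + δ) - e x) volume a b :=
    (he_mono.comp fun _ _ h => add_le_add_left h δ).intervalIntegrable.sub
      he_mono.intervalIntegrable
  calc ∫ x in a..b, Var[q x; P]
      ≤ ∫ x in a..b, (8 * V / δ ^ 2 + 4 * C * (e (x + δ) - e x)) :=
        intervalIntegral.integral_mono_on hab h_var
          (intervalIntegrable_const.add (h_incr.const_mul _))
          fun x _ => variance_subgradient_le hp hq hC h_slope hV x hδ
    _ = 8 * V / δ ^ 2 * (b - a) + 4 * C * ∫ x in a..b, (e (x + δ) - e x) := by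
        rw [intervalIntegral.integral_add intervalIntegrable_const (h_incr.const_mul _),
          intervalIntegral.integral_const, intervalIntegral.integral_const_mul, smul_eq_mul,
          mul_comm (b - a)]
    _ ≤ 8 * V / δ ^ 2 * (b - a) + 4 * C * (2 * C * δ) := by
        gcongr
        exact (le_abs_self _).trans (abs_integral_add_sub_le he_mono he_abs hδ.le a b)
    _ = _ := by ring

end Subgradient

/-- A finite spin system with Gaussian couplings indexed by `ι`, whose couplings in `inner` are
rotated into independent copies of themselves. The couplings are affine functions of independent
standard normal variables indexed by `ι ⊕ ι`. -/
structure RotatedModel (S ι : Type*) where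
  /-- The inverse temperature. -/
  β : ℝ
  /-- The spin products. -/
  spin : S → ι → ℝ
  /-- The rotated couplings. -/
  inner : Finset ι
  /-- The standard deviations. -/
  Δ : ι → ℝ
  /-- The means of the couplings that are not rotated. -/
  m : ι → ℝ
  /-- The means of the rotated couplings, up to the scale `μ`. -/
  m' : ι → ℝ
  abs_spin_le : ∀ σ X, |spin σ X| ≤ 1

namespace RotatedModel

section PairSum

variable {S ι : Type*} [Fintype ι] (M : RotatedModel S ι)

/-- The mean over the disorder of a sum over pairs of rotated couplings, weighted by the product
of their variances. -/
def pairSum (F : (ι ⊕ ι → ℝ) → ι → ι → ℝ) : ℝ :=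
  ∫ g, ∑ X ∈ M.inner, ∑ Y ∈ M.inner, M.Δ X ^ 2 * M.Δ Y ^ 2 * F g X Y ∂stdNormal (ι ⊕ ι)

lemma continuous_pairSum {Y : Type*} [TopologicalSpace Y] [FirstCountableTopology Y]
    {F : Y → (ι ⊕ ι → ℝ) → ι → ι → ℝ} (hF : ∀ X X', UniformPolyGrowth fun y g => F y g X X') :
    Continuous fun y => M.pairSum (F y) :=
  (UniformPolyGrowth.sum _ fun X _ => .sum _ fun X' _ =>
    (hF X X').const_mul _).continuous_integral

lemma pairSum_eq_sum {F : (ι ⊕ ι → ℝ) → ι → ι → ℝ}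
    (hF : ∀ X Y, Integrable (fun g => F g X Y) (stdNormal (ι ⊕ ι))) :
    M.pairSum F = ∑ X ∈ M.inner, ∑ Y ∈ M.inner,
      M.Δ X ^ 2 * M.Δ Y ^ 2 * ∫ g, F g X Y ∂stdNormal (ι ⊕ ι) := by
  have h_int (X Y : ι) := (hF X Y).const_mul (M.Δ X ^ 2 * M.Δ Y ^ 2)
  rw [pairSum, integral_finsetSum _ fun X _ => integrable_finsetSum _ fun Y _ => h_int X Y]
  simp only [integral_finsetSum _ fun Y _ => h_int _ Y, integral_const_mul]

lemma pairSum_add {F G : (ι ⊕ ι → ℝ) → ι → ι → ℝ}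
    (hF : ∀ X Y, Integrable (fun g => F g X Y) (stdNormal (ι ⊕ ι)))
    (hG : ∀ X Y, Integrable (fun g => G g X Y) (stdNormal (ι ⊕ ι))) :
    M.pairSum (fun g X Y => F g X Y + G g X Y) = M.pairSum F + M.pairSum G := by
  have h_add := M.pairSum_eq_sum (F := fun g X Y => F g X Y + G g X Y)
    fun X Y => (hF X Y).add (hG X Y)
  rw [h_add, M.pairSum_eq_sum hF, M.pairSum_eq_sum hG]
  simp only [integral_add (hF _ _) (hG _ _), mul_add, Finset.sum_add_distrib]

lemma pairSum_sub {F G : (ι ⊕ ι → ℝ) → ι → ι → ℝ}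
    (hF : ∀ X Y, Integrable (fun g => F g X Y) (stdNormal (ι ⊕ ι)))
    (hG : ∀ X Y, Integrable (fun g => G g X Y) (stdNormal (ι ⊕ ι))) :
    M.pairSum (fun g X Y => F g X Y - G g X Y) = M.pairSum F - M.pairSum G := by
  have h_sub := M.pairSum_eq_sum (F := fun g X Y => F g X Y - G g X Y)
    fun X Y => (hF X Y).sub (hG X Y)
  rw [h_sub, M.pairSum_eq_sum hF, M.pairSum_eq_sum hG]
  simp only [integral_sub (hF _ _) (hG _ _), mul_sub, Finset.sum_sub_distrib]

end PairSum

section Exponent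

variable {S ι : Type*} (M : RotatedModel S ι)

/-- The magnetization conjugate to `μ`. -/
def meanIn (σ : S) : ℝ := ∑ X ∈ M.inner, M.m' X * M.spin σ X

/-- The total mean of the rotated couplings, for `μ = 1`. -/
def totalMean : ℝ := ∑ X ∈ M.inner, |M.m' X|

lemma abs_meanIn_le (σ : S) : |M.meanIn σ| ≤ M.totalMean := by
  refine (Finset.abs_sum_le_sum_abs _ _).trans (Finset.sum_le_sum fun X _ => ?_)
  rw [abs_mul]
  exact mul_le_of_le_one_right (abs_nonneg _) (M.abs_spin_le σ X)

variable [DecidableEq ι]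

/-- The velocity of the rotation of the coupling `X`, as a covector on the Gaussian variables. -/
def dir (t : ℝ) (X : ι) : ι ⊕ ι → ℝ :=
  Sum.elim (Pi.single X (-(M.Δ X * Real.sin t))) (Pi.single X (M.Δ X * Real.cos t))

/-- The coefficients of the Gaussian variables in the exponent of the Gibbs weight. -/
def coeff (t : ℝ) (σ : S) : ι ⊕ ι → ℝ :=
  Sum.elim (fun X => M.β * M.spin σ X * M.Δ X * if X ∈ M.inner then Real.cos t else 1)
    (fun X => M.β * M.spin σ X * M.Δ X * if X ∈ M.inner then Real.sin t else 0)

lemma abs_coeff_le (t : ℝ) (σ : S) (k : ι ⊕ ι) :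
    |M.coeff t σ k| ≤ |M.β| * |Sum.elim M.Δ M.Δ k| := by
  have h_le (X : ι) {x : ℝ} (hx : |x| ≤ 1) :
      |M.β * M.spin σ X * M.Δ X * x| ≤ |M.β| * |M.Δ X| := by
    rw [abs_mul, abs_mul, abs_mul]
    refine (mul_le_of_le_one_right (by positivity) hx).trans ?_
    gcongr
    exact mul_le_of_le_one_right (abs_nonneg _) (M.abs_spin_le σ X)
  rcases k with X | X <;> refine h_le X ?_ <;> split_ifs
  · exact Real.abs_cos_le_one t
  · exact abs_one.le
  · exact Real.abs_sin_le_one t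
  · exact abs_zero.trans_le zero_le_one

variable [Fintype ι]

/-- The total variance of the couplings. -/
def totalVar : ℝ := ∑ X, M.Δ X ^ 2

/-- The deterministic part of the exponent of the Gibbs weight. -/
def drift (μ t : ℝ) (σ : S) : ℝ :=
  M.β * ((Real.cos t + Real.sin t) * μ * M.meanIn σ + ∑ X ∈ M.innerᶜ, M.m X * M.spin σ X)

/-- The exponent of the Gibbs weight. -/
def logw (μ t : ℝ) (g : ι ⊕ ι → ℝ) (σ : S) : ℝ := M.drift μ t σ + M.coeff t σ ⬝ᵥ g

lemma dir_dotProduct (t : ℝ) (X : ι) (g : ι ⊕ ι → ℝ) : M.dir t X ⬝ᵥ g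
    = M.Δ X * (Real.cos t * g (Sum.inr X) - Real.sin t * g (Sum.inl X)) := by
  simp only [dir, dotProduct, Fintype.sum_sum_type, Sum.elim_inl, Sum.elim_inr, Pi.single_apply,
    ite_mul, zero_mul, Finset.sum_ite_eq', Finset.mem_univ, if_true]
  ring

lemma coeff_dotProduct_dir (t s : ℝ) (σ : S) {X : ι} (hX : X ∈ M.inner) :
    M.coeff s σ ⬝ᵥ M.dir t X = -(M.β * Real.sin (t - s) * M.Δ X ^ 2) * M.spin σ X := by
  rw [dotProduct_comm, dir_dotProduct, Real.sin_sub]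
  simp only [coeff, Sum.elim_inl, Sum.elim_inr, if_pos hX]
  ring

lemma coeff_dotProduct_dir_self (t : ℝ) (σ : S) {X : ι} (hX : X ∈ M.inner) :
    M.coeff t σ ⬝ᵥ M.dir t X = 0 := by
  rw [M.coeff_dotProduct_dir t t σ hX, sub_self, Real.sin_zero]
  ring

lemma dir_dotProduct_dir (t s : ℝ) (X Y : ι) :
    M.dir s Y ⬝ᵥ M.dir t X = if X = Y then M.Δ X ^ 2 * Real.cos (t - s) else 0 := by
  rw [dir_dotProduct, Real.cos_sub]
  rcases eq_or_ne X Y with rfl | hXY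
  · simp only [dir, Sum.elim_inl, Sum.elim_inr, Pi.single_eq_same, if_true]
    ring
  · simp [dir, hXY, hXY.symm]

lemma coeff_dotProduct (t : ℝ) (σ : S) (g : ι ⊕ ι → ℝ) : M.coeff t σ ⬝ᵥ g
    = M.β * ∑ X, M.spin σ X * M.Δ X * if X ∈ M.inner then
        Real.cos t * g (Sum.inl X) + Real.sin t * g (Sum.inr X) else g (Sum.inl X) := by
  simp only [coeff, dotProduct, Fintype.sum_sum_type, Sum.elim_inl, Sum.elim_inr,
    ← Finset.sum_add_distrib, Finset.mul_sum]
  refine Finset.sum_congr rfl fun X _ => ?_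
  split_ifs <;> ring

lemma hasDerivAt_logw (μ t : ℝ) (g : ι ⊕ ι → ℝ) (σ : S) :
    HasDerivAt (fun t => M.logw μ t g σ)
      (M.β * ((Real.cos t - Real.sin t) * μ * M.meanIn σ
        + ∑ X ∈ M.inner, (M.dir t X ⬝ᵥ g) * M.spin σ X)) t := by
  have h_drift : HasDerivAt (fun t => M.drift μ t σ)
      (M.β * ((-Real.sin t + Real.cos t) * μ * M.meanIn σ)) t :=
    (((((Real.hasDerivAt_cos t).add (Real.hasDerivAt_sin t)).mul_const μ).mul_const
      (M.meanIn σ)).add_const _).const_mul M.β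
  have h_rotation (X : ι) : HasDerivAt (fun t => if X ∈ M.inner then
        Real.cos t * g (Sum.inl X) + Real.sin t * g (Sum.inr X) else g (Sum.inl X))
      (if X ∈ M.inner then -Real.sin t * g (Sum.inl X) + Real.cos t * g (Sum.inr X) else 0) t := by
    split_ifs
    · exact ((Real.hasDerivAt_cos t).mul_const _).add ((Real.hasDerivAt_sin t).mul_const _)
    · exact hasDerivAt_const t _
  simp only [logw, coeff_dotProduct]
  refine (h_drift.add ((HasDerivAt.fun_sum fun X _ =>
    (h_rotation X).const_mul (M.spin σ X * M.Δ X)).const_mul M.β)).congr_deriv ?_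
  simp only [dir_dotProduct, mul_ite, mul_zero, Finset.sum_ite_mem, Finset.univ_inter, ← mul_add]
  congr 2
  · ring
  · exact Finset.sum_congr rfl fun X _ => by ring

lemma continuous_logw (σ : S) :
    Continuous fun p : (ℝ × ℝ) × (ι ⊕ ι → ℝ) => M.logw p.1.1 p.1.2 p.2 σ := by
  have h_coeff (k : ι ⊕ ι) :
      Continuous fun p : (ℝ × ℝ) × (ι ⊕ ι → ℝ) => M.coeff p.1.2 σ k := by
    rcases k with X | X <;> simp only [coeff, Sum.elim_inl, Sum.elim_inr] <;> split_ifs <;> fun_prop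
  simp only [logw, drift, dotProduct]
  fun_prop

lemma logw_eq_add (μ ν t : ℝ) (g : ι ⊕ ι → ℝ) (σ : S) : M.logw ν t g σ
    = M.logw μ t g σ + (ν - μ) * (M.β * (Real.cos t + Real.sin t)) * M.meanIn σ := by
  simp only [logw, drift]
  ring

lemma uniformPolyGrowth_dir_dotProduct (X : ι) :
    UniformPolyGrowth fun (p : ℝ × ℝ) (g : ι ⊕ ι → ℝ) => M.dir p.2 X ⬝ᵥ g := by
  have h_cos : UniformPolyGrowth fun (p : ℝ × ℝ) (_ : ι ⊕ ι → ℝ) => Real.cos p.2 :=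
    .of_abs_le (by fun_prop) fun p _ => Real.abs_cos_le_one p.2
  have h_sin : UniformPolyGrowth fun (p : ℝ × ℝ) (_ : ι ⊕ ι → ℝ) => Real.sin p.2 :=
    .of_abs_le (by fun_prop) fun p _ => Real.abs_sin_le_one p.2
  simp only [dir_dotProduct]
  exact ((h_cos.mul (.eval _)).sub (h_sin.mul (.eval _))).const_mul _

end Exponent

variable {S ι : Type*} [Fintype S] [Fintype ι] [DecidableEq ι] (M : RotatedModel S ι)

/-- The Gibbs average of the spin product `X`. -/
def mag (μ t : ℝ) (g : ι ⊕ ι → ℝ) (X : ι) : ℝ := gibbs (M.logw μ t g) fun σ => M.spin σ X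

/-- The Gibbs average of the product of the spin products `X` and `Y`. -/
def pairMag (μ t : ℝ) (g : ι ⊕ ι → ℝ) (X Y : ι) : ℝ :=
  gibbs (M.logw μ t g) fun σ => M.spin σ X * M.spin σ Y

/-- The truncated correlation of the spin products `X` and `Y`. -/
def corr (μ t : ℝ) (g : ι ⊕ ι → ℝ) (X Y : ι) : ℝ :=
  M.pairMag μ t g X Y - M.mag μ t g X * M.mag μ t g Y

/-- The Gibbs average of the magnetization conjugate to `μ`. -/
def magIn (μ t : ℝ) (g : ι ⊕ ι → ℝ) : ℝ := gibbs (M.logw μ t g) M.meanIn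

/-- The pressure. -/
def press (μ t : ℝ) (g : ι ⊕ ι → ℝ) : ℝ := pressure (M.logw μ t g)

/-- The Gibbs average of the velocity of the centred energy. -/
def speed (μ t : ℝ) (g : ι ⊕ ι → ℝ) : ℝ := ∑ X ∈ M.inner, (M.dir t X ⬝ᵥ g) * M.mag μ t g X

/-- The mean overlap of two replicas. -/
def overlap (μ t s : ℝ) : ℝ :=
  ∫ g, ∑ X ∈ M.inner, M.Δ X ^ 2 * (M.mag μ t g X * M.mag μ s g X) ∂stdNormal (ι ⊕ ι)

/-- The replicon overlap: the mean product of the truncated correlations of two replicas. -/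
def replicon (μ t s : ℝ) : ℝ := M.pairSum fun g X Y => M.corr μ t g X Y * M.corr μ s g X Y

variable [Nonempty S]

section Regularity

lemma uniformPolyGrowth_gibbs_logw (f : S → ℝ) :
    UniformPolyGrowth fun (p : ℝ × ℝ) g => gibbs (M.logw p.1 p.2 g) f :=
  .of_abs_le (continuous_gibbs M.continuous_logw fun _ => continuous_const)
    fun _ _ => abs_gibbs_le_sum _ f

lemma uniformPolyGrowth_mag (X : ι) : UniformPolyGrowth fun (p : ℝ × ℝ) g => M.mag p.1 p.2 g X :=
  M.uniformPolyGrowth_gibbs_logw _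

lemma uniformPolyGrowth_pairMag (X Y : ι) :
    UniformPolyGrowth fun (p : ℝ × ℝ) g => M.pairMag p.1 p.2 g X Y :=
  M.uniformPolyGrowth_gibbs_logw _

lemma uniformPolyGrowth_corr (X Y : ι) :
    UniformPolyGrowth fun (p : ℝ × ℝ) g => M.corr p.1 p.2 g X Y :=
  (M.uniformPolyGrowth_pairMag X Y).sub
    ((M.uniformPolyGrowth_mag X).mul (M.uniformPolyGrowth_mag Y))

lemma uniformPolyGrowth_magIn : UniformPolyGrowth fun (p : ℝ × ℝ) g => M.magIn p.1 p.2 g :=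
  M.uniformPolyGrowth_gibbs_logw _

lemma uniformPolyGrowth_speed : UniformPolyGrowth fun (p : ℝ × ℝ) g => M.speed p.1 p.2 g :=
  .sum _ fun X _ => (M.uniformPolyGrowth_dir_dotProduct X).mul (M.uniformPolyGrowth_mag X)

lemma continuous_overlap (μ : ℝ) : Continuous fun p : ℝ × ℝ => M.overlap μ p.1 p.2 := by
  have h_mag (X : ι) {φ : ℝ × ℝ → ℝ} (hφ : Continuous φ) :
      UniformPolyGrowth fun p g => M.mag μ (φ p) g X :=
    (M.uniformPolyGrowth_mag X).comp (φ := fun p => (μ, φ p)) (by fun_prop)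
  exact (UniformPolyGrowth.sum _ fun X _ =>
    ((h_mag X continuous_fst).mul (h_mag X continuous_snd)).const_mul _).continuous_integral

end Regularity

section Covariance

lemma integral_speed (μ t : ℝ) : ∫ g, M.speed μ t g ∂stdNormal (ι ⊕ ι) = 0 := by
  simp only [speed]
  rw [integral_finsetSum _ fun X _ => ((M.uniformPolyGrowth_dir_dotProduct X).mul
    (M.uniformPolyGrowth_mag X)).integrable (μ, t)]
  exact Finset.sum_eq_zero fun X hX => integral_dotProduct_mul_gibbs_eq_zero (M.drift μ t)
    (M.coeff t) _ (M.dir t X) fun σ => M.coeff_dotProduct_dir_self t σ hX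

lemma integral_dir_dotProduct_mul_mag_mul (μ t s : ℝ) {X Y : ι} (hX : X ∈ M.inner)
    (hY : Y ∈ M.inner) :
    ∫ g, (M.dir t X ⬝ᵥ g) * M.mag μ t g X * ((M.dir s Y ⬝ᵥ g) * M.mag μ s g Y) ∂stdNormal (ι ⊕ ι)
      = (if X = Y then M.Δ X ^ 2 * Real.cos (t - s) else 0)
          * ∫ g, M.mag μ t g X * M.mag μ s g Y ∂stdNormal (ι ⊕ ι)
        - M.β ^ 2 * Real.sin (t - s) ^ 2 * (M.Δ X ^ 2 * M.Δ Y ^ 2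
          * ∫ g, M.corr μ t g X Y * M.corr μ s g X Y ∂stdNormal (ι ⊕ ι)) := by
  have h_stein := integral_dotProduct_mul_dotProduct_mul_gibbs (M.drift μ t) (M.drift μ s)
    (M.coeff t) (M.coeff s) (fun σ => M.spin σ X) (fun σ => M.spin σ Y) (M.dir s Y) (M.dir t X)
    (fun σ => M.coeff_dotProduct_dir_self t σ hX) (fun σ => M.coeff_dotProduct_dir_self s σ hY)
  simp only [M.coeff_dotProduct_dir _ _ _ hX, M.coeff_dotProduct_dir _ _ _ hY,
    gibbsCov_const_mul, dir_dotProduct_dir] at h_stein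
  have h_corr (t : ℝ) (g : ι ⊕ ι → ℝ) : gibbsCov (fun σ => M.drift μ t σ + M.coeff t σ ⬝ᵥ g)
      (fun σ => M.spin σ X) (fun σ => M.spin σ Y) = M.corr μ t g X Y := rfl
  have h_mag (t : ℝ) (g : ι ⊕ ι → ℝ) (X : ι) : gibbs (fun σ => M.drift μ t σ + M.coeff t σ ⬝ᵥ g)
      (fun σ => M.spin σ X) = M.mag μ t g X := rfl
  have h_sin : Real.sin (s - t) = -Real.sin (t - s) := by rw [← Real.sin_neg, neg_sub]
  calc _ = _ := by simp only [mul_mul_mul_comm _ (M.mag μ t _ X), mul_assoc]; exact h_stein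
    _ = _ := by
      simp only [gibbsCov_comm _ (fun σ => M.spin σ Y), h_corr, h_mag, h_sin,
        mul_mul_mul_comm _ (M.corr μ t _ X Y), integral_const_mul]
      ring_nf

lemma integral_speed_mul_speed (μ t s : ℝ) :
    ∫ g, M.speed μ t g * M.speed μ s g ∂stdNormal (ι ⊕ ι)
      = Real.cos (t - s) * M.overlap μ t s
        - M.β ^ 2 * (Real.sin (t - s) ^ 2 * M.replicon μ t s) := by
  have h_int_speed (X Y : ι) : Integrable (fun g => (M.dir t X ⬝ᵥ g) * M.mag μ t g X
      * ((M.dir s Y ⬝ᵥ g) * M.mag μ s g Y)) (stdNormal (ι ⊕ ι)) := by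
    have h (t : ℝ) (X : ι) := ((M.uniformPolyGrowth_dir_dotProduct X).mul
      (M.uniformPolyGrowth_mag X)).memLp_two (μ, t)
    exact (h t X).integrable_mul (h s Y)
  have h_int_mag (X : ι) : Integrable (fun g => M.mag μ t g X * M.mag μ s g X)
      (stdNormal (ι ⊕ ι)) :=
    ((M.uniformPolyGrowth_mag X).memLp_two (μ, t)).integrable_mul
      ((M.uniformPolyGrowth_mag X).memLp_two (μ, s))
  have h_int_corr (X Y : ι) : Integrable (fun g => M.corr μ t g X Y * M.corr μ s g X Y)
      (stdNormal (ι ⊕ ι)) :=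
    ((M.uniformPolyGrowth_corr X Y).memLp_two (μ, t)).integrable_mul
      ((M.uniformPolyGrowth_corr X Y).memLp_two (μ, s))
  simp only [speed, Finset.sum_mul_sum]
  rw [integral_finsetSum _ fun X _ => integrable_finsetSum _ fun Y _ => h_int_speed X Y,
    overlap, integral_finsetSum _ fun X _ => (h_int_mag X).const_mul _,
    replicon, M.pairSum_eq_sum h_int_corr]
  simp only [Finset.mul_sum, ← Finset.sum_sub_distrib]
  refine Finset.sum_congr rfl fun X hX => ?_
  rw [integral_finsetSum _ fun Y _ => h_int_speed X Y,
    Finset.sum_congr rfl fun Y hY => M.integral_dir_dotProduct_mul_mag_mul μ t s hX hY,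
    Finset.sum_sub_distrib]
  congr 1
  · simp only [ite_mul, zero_mul, Finset.sum_ite_eq, hX, if_true, integral_const_mul]
    ring
  · simp only [mul_assoc]

end Covariance


section Fluctuation

lemma coordLipschitz_press (μ t : ℝ) :
    CoordLipschitz (fun k => |M.β| * |Sum.elim M.Δ M.Δ k|) (M.press μ t) := fun g g' => by
  refine abs_pressure_sub_le fun σ => ?_
  rw [logw, logw, add_sub_add_left_eq_sub, ← dotProduct_sub]
  refine (Finset.abs_sum_le_sum_abs _ _).trans (Finset.sum_le_sum fun k _ => ?_)
  rw [abs_mul]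
  exact mul_le_mul_of_nonneg_right (M.abs_coeff_le t σ k) (abs_nonneg _)

lemma memLp_press (μ t : ℝ) : MemLp (M.press μ t) 2 (stdNormal (ι ⊕ ι)) :=
  (M.coordLipschitz_press μ t).memLp_two fun _ => memLp_id_gaussianReal 2

lemma variance_press_le (μ t : ℝ) :
    Var[M.press μ t; stdNormal (ι ⊕ ι)] ≤ 2 * M.β ^ 2 * M.totalVar := by
  refine ((M.coordLipschitz_press μ t).variance_le fun _ => memLp_id_gaussianReal 2).trans_eq ?_
  simp only [Fintype.sum_sum_type, Sum.elim_inl, Sum.elim_inr, mul_pow, sq_abs,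
    variance_id_gaussianReal, NNReal.coe_one, mul_one, ← Finset.mul_sum, totalVar]
  ring

/-- The variance of the Gibbs average of the magnetization conjugate to `μ`. -/
def varMagIn (μ t : ℝ) : ℝ := Var[M.magIn μ t; stdNormal (ι ⊕ ι)]

lemma continuous_varMagIn : Continuous fun p : ℝ × ℝ => M.varMagIn p.1 p.2 :=
  M.uniformPolyGrowth_magIn.continuous_variance

lemma abs_magIn_le (μ t : ℝ) (g : ι ⊕ ι → ℝ) : |M.magIn μ t g| ≤ M.totalMean :=
  abs_gibbs_le _ M.abs_meanIn_le

lemma varMagIn_le (μ t : ℝ) : M.varMagIn μ t ≤ M.totalMean ^ 2 := by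
  have h_memLp : MemLp (M.magIn μ t) 2 (stdNormal (ι ⊕ ι)) :=
    M.uniformPolyGrowth_magIn.memLp_two (μ, t)
  calc M.varMagIn μ t ≤ ∫ g, M.magIn μ t g ^ 2 ∂stdNormal (ι ⊕ ι) :=
        (variance_le_expectation_sq h_memLp.aestronglyMeasurable).trans_eq rfl
    _ ≤ ∫ _, M.totalMean ^ 2 ∂stdNormal (ι ⊕ ι) :=
        integral_mono h_memLp.integrable_sq (integrable_const _) fun g =>
          sq_le_sq' (abs_le.1 (M.abs_magIn_le μ t g)).1 (abs_le.1 (M.abs_magIn_le μ t g)).2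
    _ = M.totalMean ^ 2 := by simp

lemma press_add_mul_magIn_le (t : ℝ) (g : ι ⊕ ι → ℝ) (μ ν : ℝ) :
    M.press μ t g + (ν - μ) * (M.β * (Real.cos t + Real.sin t) * M.magIn μ t g)
      ≤ M.press ν t g := by
  have h_tangent := pressure_add_gibbs_le (M.logw μ t g)
    fun σ => (ν - μ) * (M.β * (Real.cos t + Real.sin t)) * M.meanIn σ
  rw [gibbs_const_mul, mul_assoc] at h_tangent
  simpa only [← logw_eq_add, press, magIn] using h_tangent

lemma integral_varMagIn_le (hβ : M.β ≠ 0) {t : ℝ} (ht : Real.cos t + Real.sin t ≠ 0) {μ₁ μ₂ : ℝ}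
    (hμ : μ₁ ≤ μ₂) {δ : ℝ} (hδ : 0 < δ) :
    ∫ μ in μ₁..μ₂, M.varMagIn μ t
      ≤ 16 * M.totalVar / ((Real.cos t + Real.sin t) * δ) ^ 2 * (μ₂ - μ₁)
        + 8 * M.totalMean ^ 2 * δ := by
  set b := M.β * (Real.cos t + Real.sin t) with hb
  have hb_sq : 0 < b ^ 2 := sq_pos_iff.2 (mul_ne_zero hβ ht)
  have h_var (μ : ℝ) : Var[fun g => b * M.magIn μ t g; stdNormal (ι ⊕ ι)]
      = b ^ 2 * M.varMagIn μ t := variance_const_mul _ _ _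
  have h_cont : Continuous fun μ => M.varMagIn μ t :=
    M.continuous_varMagIn.comp (f := fun μ => (μ, t)) (by fun_prop)
  have h_subgradient := integral_variance_subgradient_le (P := stdNormal (ι ⊕ ι))
    (p := fun μ => M.press μ t) (q := fun μ g => b * M.magIn μ t g) (C := |b| * M.totalMean)
    (fun μ => M.memLp_press μ t)
    (fun μ => ((M.uniformPolyGrowth_magIn.memLp_two (μ, t)).const_mul b).aestronglyMeasurable)
    (fun μ g => by rw [abs_mul]; gcongr; exact M.abs_magIn_le μ t g)
    (M.press_add_mul_magIn_le t) (fun μ => M.variance_press_le μ t) hμ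
    (by simpa only [h_var] using (h_cont.const_mul _).intervalIntegrable _ _) hδ
  simp only [h_var, intervalIntegral.integral_const_mul, mul_pow |b|, sq_abs] at h_subgradient
  rw [← mul_le_mul_iff_right₀ hb_sq]
  refine h_subgradient.trans_eq ?_
  rw [hb]
  field_simp
  ring

end Fluctuation

section Flow

lemma hasDerivAt_press (μ t : ℝ) (g : ι ⊕ ι → ℝ) :
    HasDerivAt (fun t => M.press μ t g)
      (M.β * (M.speed μ t g + (Real.cos t - Real.sin t) * μ * M.magIn μ t g)) t := by
  refine (hasDerivAt_pressure (M.hasDerivAt_logw μ t g)).congr_deriv ?_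
  simp only [gibbs_const_mul, gibbs_add, gibbs_sum, add_comm (M.speed μ t g)]
  rfl

/-- The contribution of the centred couplings to the change of the pressure under the flip, which
is the rotation by `π`. -/
def flow (μ : ℝ) (g : ι ⊕ ι → ℝ) : ℝ := ∫ t in (0 : ℝ)..Real.pi, M.speed μ t g

/-- The contribution of the means to the change of the pressure under the flip. -/
def meanFlow (μ : ℝ) (g : ι ⊕ ι → ℝ) : ℝ :=
  ∫ t in (0 : ℝ)..Real.pi, (Real.cos t - Real.sin t) * μ * M.magIn μ t g

lemma uniformPolyGrowth_speed_left (μ : ℝ) : UniformPolyGrowth (M.speed μ) :=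
  M.uniformPolyGrowth_speed.comp (φ := fun t => (μ, t)) (by fun_prop)

lemma uniformPolyGrowth_mul_magIn_left (μ : ℝ) :
    UniformPolyGrowth fun t g => (Real.cos t - Real.sin t) * μ * M.magIn μ t g := by
  have h_magIn : UniformPolyGrowth (M.magIn μ) :=
    M.uniformPolyGrowth_magIn.comp (φ := fun t => (μ, t)) (by fun_prop)
  refine .of_abs_le (C := 2 * |μ| * M.totalMean)
    (Continuous.mul (by fun_prop) h_magIn.continuous) fun t g => ?_
  rw [abs_mul, abs_mul]
  gcongr
  · linarith [abs_sub (Real.cos t) (Real.sin t), Real.abs_cos_le_one t, Real.abs_sin_le_one t]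
  · exact M.abs_magIn_le μ t g

lemma flow_eq (hβ : M.β ≠ 0) (μ : ℝ) (g : ι ⊕ ι → ℝ) :
    M.flow μ g = M.β⁻¹ * (M.press μ Real.pi g - M.press μ 0 g) - M.meanFlow μ g := by
  have h_speed := (M.uniformPolyGrowth_speed_left μ).continuous.uncurry_right g
  have h_mean := (M.uniformPolyGrowth_mul_magIn_left μ).continuous.uncurry_right g
  rw [← intervalIntegral.integral_eq_sub_of_hasDerivAt (fun t _ => M.hasDerivAt_press μ t g)
      (((h_speed.add h_mean).const_mul M.β).intervalIntegrable 0 Real.pi),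
    intervalIntegral.integral_const_mul, inv_mul_cancel_left₀ hβ,
    intervalIntegral.integral_add (h_speed.intervalIntegrable _ _) (h_mean.intervalIntegrable _ _),
    flow, meanFlow, add_sub_cancel_right]

lemma integral_flow (μ : ℝ) : ∫ g, M.flow μ g ∂stdNormal (ι ⊕ ι) = 0 := by
  simp only [flow, (M.uniformPolyGrowth_speed_left μ).integral_intervalIntegral, integral_speed,
    intervalIntegral.integral_zero]

lemma continuous_replicon (μ : ℝ) : Continuous fun p : ℝ × ℝ => M.replicon μ p.1 p.2 :=
  M.continuous_pairSum fun X Y =>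
    ((M.uniformPolyGrowth_corr X Y).comp (φ := fun p : ℝ × ℝ => (μ, p.1)) (by fun_prop)).mul
      ((M.uniformPolyGrowth_corr X Y).comp (φ := fun p : ℝ × ℝ => (μ, p.2)) (by fun_prop))

lemma integral_flow_sq (μ : ℝ) :
    ∫ g, M.flow μ g ^ 2 ∂stdNormal (ι ⊕ ι)
      = (∫ t in (0 : ℝ)..Real.pi, ∫ s in (0 : ℝ)..Real.pi, Real.cos (t - s) * M.overlap μ t s)
        - M.β ^ 2 * ∫ t in (0 : ℝ)..Real.pi, ∫ s in (0 : ℝ)..Real.pi,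
          Real.sin (t - s) ^ 2 * M.replicon μ t s := by
  have h_overlap : Continuous (Function.uncurry fun t s => Real.cos (t - s) * M.overlap μ t s) :=
    Continuous.mul (by fun_prop) (M.continuous_overlap μ)
  have h_replicon : Continuous (Function.uncurry fun t s =>
      M.β ^ 2 * (Real.sin (t - s) ^ 2 * M.replicon μ t s)) :=
    (Continuous.mul (by fun_prop) (M.continuous_replicon μ)).const_mul _
  simp only [flow, (M.uniformPolyGrowth_speed_left μ).integral_sq_intervalIntegral,
    integral_speed_mul_speed]
  rw [intervalIntegral_intervalIntegral_sub h_overlap h_replicon]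
  simp only [intervalIntegral.integral_const_mul]

lemma abs_overlap_le (μ t s : ℝ) : |M.overlap μ t s| ≤ M.totalVar := by
  have h_mag (t : ℝ) (g : ι ⊕ ι → ℝ) (X : ι) : |M.mag μ t g X| ≤ 1 :=
    abs_gibbs_le _ fun σ => M.abs_spin_le σ X
  have h_sum (g : ι ⊕ ι → ℝ) :
      ‖∑ X ∈ M.inner, M.Δ X ^ 2 * (M.mag μ t g X * M.mag μ s g X)‖ ≤ M.totalVar := by
    refine (norm_sum_le _ _).trans ((Finset.sum_le_sum fun X _ => ?_).trans
      (Finset.sum_le_univ_sum_of_nonneg fun X => sq_nonneg (M.Δ X)))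
    rw [Real.norm_eq_abs, abs_mul, abs_mul, abs_sq]
    exact mul_le_of_le_one_right (sq_nonneg _)
      (mul_le_one₀ (h_mag t g X) (abs_nonneg _) (h_mag s g X))
  simpa [overlap] using norm_integral_le_of_norm_le_const (ae_of_all (stdNormal (ι ⊕ ι)) h_sum)

lemma abs_integral_cos_mul_overlap_le (μ : ℝ) :
    |∫ t in (0 : ℝ)..Real.pi, ∫ s in (0 : ℝ)..Real.pi, Real.cos (t - s) * M.overlap μ t s|
      ≤ Real.pi ^ 2 * M.totalVar := by
  have h_abs (t s : ℝ) : |Real.cos (t - s) * M.overlap μ t s| ≤ M.totalVar := by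
    rw [abs_mul]
    exact (mul_le_of_le_one_left (abs_nonneg _) (Real.abs_cos_le_one _)).trans
      (M.abs_overlap_le μ t s)
  refine (abs_intervalIntegral_le (fun t => abs_intervalIntegral_le (h_abs t) Real.pi_pos.le)
    Real.pi_pos.le).trans_eq ?_
  ring

lemma variance_meanFlow_le (μ : ℝ) :
    Var[M.meanFlow μ; stdNormal (ι ⊕ ι)]
      ≤ 2 * Real.pi * μ ^ 2 * ∫ t in (0 : ℝ)..Real.pi, M.varMagIn μ t := by
  have h_growth := M.uniformPolyGrowth_mul_magIn_left μ
  have h_varMagIn : Continuous fun t => M.varMagIn μ t :=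
    M.continuous_varMagIn.comp (f := fun t => (μ, t)) (by fun_prop)
  have h_var (t : ℝ) : Var[fun g => (Real.cos t - Real.sin t) * μ * M.magIn μ t g;
      stdNormal (ι ⊕ ι)] ≤ 2 * μ ^ 2 * M.varMagIn μ t := by
    have h_trig : (Real.cos t - Real.sin t) ^ 2 ≤ 2 := by
      linarith [sq_nonneg (Real.cos t + Real.sin t), Real.cos_sq_add_sin_sq t]
    rw [variance_const_mul, mul_pow]
    exact mul_le_mul_of_nonneg_right (by gcongr) (variance_nonneg _ _)
  calc Var[M.meanFlow μ; stdNormal (ι ⊕ ι)]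
      ≤ (Real.pi - 0) * ∫ t in (0 : ℝ)..Real.pi,
        Var[fun g => (Real.cos t - Real.sin t) * μ * M.magIn μ t g; stdNormal (ι ⊕ ι)] :=
        h_growth.variance_intervalIntegral_le Real.pi_pos.le
    _ ≤ (Real.pi - 0) * ∫ t in (0 : ℝ)..Real.pi, 2 * μ ^ 2 * M.varMagIn μ t := by
        gcongr
        · linarith [Real.pi_pos]
        · exact intervalIntegral.integral_mono_on Real.pi_pos.le
            (h_growth.continuous_variance.intervalIntegrable _ _)
            ((h_varMagIn.const_mul _).intervalIntegrable _ _) fun t _ => h_var t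
    _ = _ := by
        rw [intervalIntegral.integral_const_mul]
        ring

lemma integral_flow_sq_le (hβ : M.β ≠ 0) (μ : ℝ) :
    ∫ g, M.flow μ g ^ 2 ∂stdNormal (ι ⊕ ι)
      ≤ 16 * M.totalVar + 4 * Real.pi * μ ^ 2 * ∫ t in (0 : ℝ)..Real.pi, M.varMagIn μ t := by
  have h_press := (M.memLp_press μ Real.pi).sub (M.memLp_press μ 0)
  have h_var_press : Var[fun g => M.β⁻¹ * (M.press μ Real.pi - M.press μ 0) g;
      stdNormal (ι ⊕ ι)] ≤ 8 * M.totalVar := by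
    have h_sub : Var[M.press μ Real.pi - M.press μ 0; stdNormal (ι ⊕ ι)] ≤ _ :=
      variance_fun_sub_le (M.memLp_press μ Real.pi) (M.memLp_press μ 0)
    rw [variance_const_mul, inv_pow, inv_mul_le_iff₀ (by positivity)]
    linarith [M.variance_press_le μ Real.pi, M.variance_press_le μ 0]
  have h_meanFlow : MemLp (M.meanFlow μ) 2 (stdNormal (ι ⊕ ι)) :=
    ((M.uniformPolyGrowth_mul_magIn_left μ).intervalIntegral (Y := Unit) 0 Real.pi).memLp_two ()
  calc ∫ g, M.flow μ g ^ 2 ∂stdNormal (ι ⊕ ι)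
      = Var[M.flow μ; stdNormal (ι ⊕ ι)] :=
        (variance_of_integral_eq_zero (((M.uniformPolyGrowth_speed_left μ).intervalIntegral
          (Y := Unit) 0 Real.pi).memLp_two ()).aemeasurable (M.integral_flow μ)).symm
    _ = Var[fun g => M.β⁻¹ * (M.press μ Real.pi - M.press μ 0) g - M.meanFlow μ g;
        stdNormal (ι ⊕ ι)] := by rw [funext (M.flow_eq hβ μ)]; rfl
    _ ≤ _ := variance_fun_sub_le (h_press.const_mul _) h_meanFlow
    _ ≤ _ := by linarith [M.variance_meanFlow_le μ]

lemma sq_mul_abs_integral_replicon_le (hβ : M.β ≠ 0) (μ : ℝ) :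
    M.β ^ 2 * |∫ t in (0 : ℝ)..Real.pi, ∫ s in (0 : ℝ)..Real.pi,
        Real.sin (t - s) ^ 2 * M.replicon μ t s|
      ≤ (Real.pi ^ 2 + 16) * M.totalVar
        + 4 * Real.pi * μ ^ 2 * ∫ t in (0 : ℝ)..Real.pi, M.varMagIn μ t := by
  have h_flow_nonneg : 0 ≤ ∫ g, M.flow μ g ^ 2 ∂stdNormal (ι ⊕ ι) :=
    integral_nonneg fun _ => sq_nonneg _
  have h_flow := M.integral_flow_sq μ
  have h_overlap := abs_le.1 (M.abs_integral_cos_mul_overlap_le μ)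
  rw [← abs_sq M.β, ← abs_mul, abs_le]
  constructor <;> linarith [M.integral_flow_sq_le hβ μ]

end Flow


section RepliconPoly

/-- The mean of the product of the overlaps of a replica at `t` with two replicas at `s`. -/
def mixed (μ t s : ℝ) : ℝ :=
  M.pairSum fun g X Y => M.mag μ s g X * M.pairMag μ t g X Y * M.mag μ s g Y

/-- The counterpart of `SpinFlip.repliconPoly`, up to normalization by the volume. -/
def repliconPoly (μ t s : ℝ) : ℝ :=
  M.pairSum (fun g X Y => M.pairMag μ t g X Y * M.pairMag μ s g X Y)
    - 2 * M.mixed μ t s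
    + M.pairSum fun g X Y => M.mag μ t g X * M.mag μ s g X * (M.mag μ s g Y * M.mag μ t g Y)

lemma continuous_mixed (μ : ℝ) : Continuous fun p : ℝ × ℝ => M.mixed μ p.1 p.2 := by
  have h_mag (X : ι) := (M.uniformPolyGrowth_mag X).comp (φ := fun p : ℝ × ℝ => (μ, p.2))
    (by fun_prop)
  have h_pairMag (X Y : ι) := (M.uniformPolyGrowth_pairMag X Y).comp
    (φ := fun p : ℝ × ℝ => (μ, p.1)) (by fun_prop)
  exact M.continuous_pairSum fun X Y => ((h_mag X).mul (h_pairMag X Y)).mul (h_mag Y)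

lemma repliconPoly_eq_replicon_add (μ t s : ℝ) :
    M.repliconPoly μ t s = M.replicon μ t s + (M.mixed μ s t - M.mixed μ t s) := by
  have h_mag (t : ℝ) (X : ι) : UniformPolyGrowth fun (_ : Unit) g => M.mag μ t g X :=
    (M.uniformPolyGrowth_mag X).comp (φ := fun _ => (μ, t)) continuous_const
  have h_pairMag (t : ℝ) (X Y : ι) : UniformPolyGrowth fun (_ : Unit) g => M.pairMag μ t g X Y :=
    (M.uniformPolyGrowth_pairMag X Y).comp (φ := fun _ => (μ, t)) continuous_const
  have h_pair_pair (X Y : ι) := (h_pairMag t X Y).mul (h_pairMag s X Y)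
  have h_mixed (t s : ℝ) (X Y : ι) := ((h_mag s X).mul (h_pairMag t X Y)).mul (h_mag s Y)
  have h_mags (X Y : ι) :=
    ((h_mag t X).mul (h_mag s X)).mul ((h_mag s Y).mul (h_mag t Y))
  have h_diff (X Y : ι) := (h_pair_pair X Y).sub (h_mixed t s X Y)
  have h_replicon := calc
    M.replicon μ t s = M.pairSum (fun g X Y => M.pairMag μ t g X Y * M.pairMag μ s g X Y
        - M.mag μ s g X * M.pairMag μ t g X Y * M.mag μ s g Y
        - M.mag μ t g X * M.pairMag μ s g X Y * M.mag μ t g Y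
        + M.mag μ t g X * M.mag μ s g X * (M.mag μ s g Y * M.mag μ t g Y)) := by
        simp only [replicon, corr]
        congr! 4
        ring
    _ = _ := by
        rw [M.pairSum_add (fun X Y => ((h_diff X Y).sub (h_mixed s t X Y)).integrable ())
            (fun X Y => (h_mags X Y).integrable ()),
          M.pairSum_sub (fun X Y => (h_diff X Y).integrable ())
            (fun X Y => (h_mixed s t X Y).integrable ()),
          M.pairSum_sub (fun X Y => (h_pair_pair X Y).integrable ())
            (fun X Y => (h_mixed t s X Y).integrable ())]
  rw [h_replicon, repliconPoly, mixed, mixed]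
  ring

lemma integral_sin_sq_mul_repliconPoly (μ : ℝ) :
    ∫ t in (0 : ℝ)..Real.pi, ∫ s in (0 : ℝ)..Real.pi,
        Real.sin (t - s) ^ 2 * M.repliconPoly μ t s
      = ∫ t in (0 : ℝ)..Real.pi, ∫ s in (0 : ℝ)..Real.pi,
        Real.sin (t - s) ^ 2 * M.replicon μ t s := by
  have h_sin (t s : ℝ) : Real.sin (s - t) ^ 2 = Real.sin (t - s) ^ 2 := by
    rw [← neg_sub, Real.sin_neg, neg_sq]
  have h_replicon : Continuous (Function.uncurry fun t s =>
      Real.sin (t - s) ^ 2 * M.replicon μ t s) :=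
    Continuous.mul (by fun_prop) (M.continuous_replicon μ)
  have h_mixed_swap : Continuous fun p : ℝ × ℝ => M.mixed μ p.2 p.1 :=
    (M.continuous_mixed μ).comp (f := fun p : ℝ × ℝ => (p.2, p.1)) (by fun_prop)
  have h_mixed : Continuous (Function.uncurry fun t s =>
      Real.sin (t - s) ^ 2 * (M.mixed μ t s - M.mixed μ s t)) :=
    Continuous.mul (by fun_prop) ((M.continuous_mixed μ).sub h_mixed_swap)
  have h_antisymm := intervalIntegral_intervalIntegral_eq_zero_of_antisymm h_mixed
    (fun t s => by rw [h_sin]; ring) 0 Real.pi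
  have h_split (t s : ℝ) : Real.sin (t - s) ^ 2 * M.repliconPoly μ t s
      = Real.sin (t - s) ^ 2 * M.replicon μ t s
        - Real.sin (t - s) ^ 2 * (M.mixed μ t s - M.mixed μ s t) := by
    rw [repliconPoly_eq_replicon_add]
    ring
  simp only [h_split]
  rw [intervalIntegral_intervalIntegral_sub h_replicon h_mixed, h_antisymm, sub_zero]

lemma sq_mul_abs_integral_integral_repliconPoly_le (hβ : M.β ≠ 0) {μ₁ μ₂ : ℝ} (hμ : μ₁ ≤ μ₂) :
    M.β ^ 2 * |∫ μ in μ₁..μ₂, ∫ t in (0 : ℝ)..Real.pi, ∫ s in (0 : ℝ)..Real.pi,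
        Real.sin (t - s) ^ 2 * M.repliconPoly μ t s|
      ≤ (Real.pi ^ 2 + 16) * M.totalVar * (μ₂ - μ₁)
        + 4 * Real.pi * (μ₁ ^ 2 + μ₂ ^ 2) *
          ∫ t in (0 : ℝ)..Real.pi, ∫ μ in μ₁..μ₂, M.varMagIn μ t := by
  have h_sq {μ : ℝ} (hμI : μ ∈ Set.Ioc μ₁ μ₂) : μ ^ 2 ≤ μ₁ ^ 2 + μ₂ ^ 2 := by
    rcases le_total 0 μ with h | h <;>
      nlinarith [hμI.1, hμI.2, sq_nonneg μ₁, sq_nonneg μ₂]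
  have h_bound : Continuous fun μ => 4 * Real.pi * (μ₁ ^ 2 + μ₂ ^ 2) *
      ∫ t in (0 : ℝ)..Real.pi, M.varMagIn μ t :=
    (continuous_intervalIntegral (f := fun t μ => M.varMagIn μ t)
      (M.continuous_varMagIn.comp (f := fun p : ℝ × ℝ => (p.2, p.1)) (by fun_prop)) _ _).const_mul _
  have h_le (μ : ℝ) (hμI : μ ∈ Set.Ioc μ₁ μ₂) :
      ‖M.β ^ 2 * ∫ t in (0 : ℝ)..Real.pi, ∫ s in (0 : ℝ)..Real.pi,
        Real.sin (t - s) ^ 2 * M.repliconPoly μ t s‖ ≤ (Real.pi ^ 2 + 16) * M.totalVar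
      + 4 * Real.pi * (μ₁ ^ 2 + μ₂ ^ 2) * ∫ t in (0 : ℝ)..Real.pi, M.varMagIn μ t := by
    have h_nonneg : 0 ≤ ∫ t in (0 : ℝ)..Real.pi, M.varMagIn μ t :=
      intervalIntegral.integral_nonneg Real.pi_pos.le fun t _ => variance_nonneg _ _
    rw [Real.norm_eq_abs, abs_mul, abs_sq, integral_sin_sq_mul_repliconPoly]
    refine (M.sq_mul_abs_integral_replicon_le hβ μ).trans ?_
    gcongr
    exact h_sq hμI
  have h_norm := intervalIntegral.norm_integral_le_of_norm_le hμ (ae_of_all volume h_le)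
    ((continuous_const.add h_bound).intervalIntegrable _ _)
  rw [intervalIntegral.integral_const_mul, Real.norm_eq_abs, abs_mul, abs_sq] at h_norm
  refine h_norm.trans_eq ?_
  rw [intervalIntegral.integral_add (continuous_const.intervalIntegrable _ _)
      (h_bound.intervalIntegrable _ _), intervalIntegral.integral_const,
    intervalIntegral.integral_const_mul,
    intervalIntegral_swap_of_continuous (f := M.varMagIn) M.continuous_varMagIn,
    smul_eq_mul, mul_comm (μ₂ - μ₁)]

end RepliconPoly

end RotatedModel

section Lattice

variable {d : ℕ} (β : ℝ) (Δ m m' : Finset (Site d) → ℝ) (Λ Λ' : Finset (Site d))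

lemma abs_spinProd_le {Λ : Finset (Site d)} (σ : Config Λ) (X : Finset (Site d)) :
    |spinProd σ X| ≤ 1 := by
  unfold spinProd
  split_ifs
  · simp
  · rw [Finset.abs_prod]
    refine Finset.prod_le_one (fun _ _ => abs_nonneg _) fun i _ => ?_
    split_ifs
    · rcases Int.units_eq_one_or (σ i) with h | h <;> simp [h]
    · simp

/-- The interpolation of the flip of `Λ'` as a rotated model. -/
def latticeModel : RotatedModel (Config Λ) ↥Λ.powerset where
  β := β
  spin σ X := spinProd σ X
  inner := {X | (X : Finset (Site d)) ⊆ Λ'}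
  Δ X := Δ X
  m X := m X
  m' X := m' X
  abs_spin_le σ X := abs_spinProd_le σ X

/-- The disorder `(J, J̃)` as an affine function of standard normal variables. -/
def couplings (μ : ℝ) (g : ↥Λ.powerset ⊕ ↥Λ.powerset → ℝ) : Couplings Λ × Couplings Λ :=
  (fun X => paramMean m m' Λ' μ X + Δ X * g (Sum.inl X),
    fun X => paramMean m m' Λ' μ X + Δ X * g (Sum.inr X))

lemma measurePreserving_add_mul_gaussianReal (a b : ℝ) :
    MeasurePreserving (fun x => a + b * x) (gaussianReal 0 1)
      (gaussianReal a ⟨b ^ 2, sq_nonneg _⟩) := by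
  refine ⟨by fun_prop, ?_⟩
  have h_comp : (fun x : ℝ => a + b * x) = (a + ·) ∘ (b * ·) := rfl
  rw [h_comp, ← Measure.map_map (by fun_prop) (by fun_prop), gaussianReal_map_const_mul,
    gaussianReal_map_const_add, mul_zero, zero_add, mul_one]
  rfl

lemma measurePreserving_couplings (μ : ℝ) :
    MeasurePreserving (couplings Δ m m' Λ Λ' μ) (stdNormal (↥Λ.powerset ⊕ ↥Λ.powerset))
      (disorderLaw Λ (paramMean m m' Λ' μ) Δ) := by
  have (X : ↥Λ.powerset) : IsProbabilityMeasure
      (gaussianReal (paramMean m m' Λ' μ X) ⟨Δ X ^ 2, sq_nonneg _⟩) :=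
    instIsProbabilityMeasureGaussianReal _ _
  have : SigmaFinite (couplingLaw Λ (paramMean m m' Λ' μ) Δ) := by
    unfold couplingLaw
    infer_instance
  have h_affine : MeasurePreserving
      (fun (g : ↥Λ.powerset → ℝ) (X : ↥Λ.powerset) => paramMean m m' Λ' μ X + Δ X * g X)
      (Measure.pi fun _ => gaussianReal 0 1) (couplingLaw Λ (paramMean m m' Λ' μ) Δ) :=
    measurePreserving_pi _ _ fun X => measurePreserving_add_mul_gaussianReal _ _
  exact (h_affine.prod h_affine).comp
    (measurePreserving_sumPiEquivProdPi (X := fun _ => ℝ) fun _ => gaussianReal 0 1)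

lemma logw_latticeModel (μ t : ℝ) (g : ↥Λ.powerset ⊕ ↥Λ.powerset → ℝ) :
    (latticeModel β Δ m m' Λ Λ').logw μ t g
      = fun σ => -β * interpHam Λ' t (couplings Δ m m' Λ Λ' μ g) σ := by
  funext σ
  rw [RotatedModel.logw, RotatedModel.drift, RotatedModel.coeff_dotProduct, RotatedModel.meanIn]
  simp only [interpHam, hamIn, hamOut, couplings, latticeModel, Finset.compl_filter,
    Finset.sum_filter, Finset.mem_filter_univ, mul_neg, neg_mul, ← neg_add, neg_neg,
    ← mul_add, Finset.mul_sum, ← Finset.sum_add_distrib, ← Finset.sum_neg_distrib]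
  refine Finset.sum_congr rfl fun X _ => ?_
  by_cases hX : (X : Finset (Site d)) ⊆ Λ'
  · simp only [paramMean, hX, not_true_eq_false, if_true, if_false]
    ring
  · simp only [paramMean, hX, not_false_eq_true, if_true, if_false]
    ring

lemma spin_latticeModel (σ : Config Λ) (X : ↥Λ.powerset) :
    (latticeModel β Δ m m' Λ Λ').spin σ X = spinProd σ X := rfl

section RandomState

variable {Λ : Finset (Site d)} {n : ℕ} (t : Fin n → ℝ)

lemma randomState_eq_prod_gibbs (ω : Couplings Λ × Couplings Λ) {f : (Fin n → Config Λ) → ℝ}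
    {φ : Fin n → Config Λ → ℝ} (hf : ∀ σ, f σ = ∏ k, φ k (σ k)) :
    randomState β Λ' t ω f = ∏ k, gibbs (fun σ => -β * interpHam Λ' (t k) ω σ) (φ k) := by
  simp only [randomState, partitionFn, gibbs, hf, ← Finset.prod_mul_distrib, div_eq_inv_mul]
  rw [Finset.prod_mul_distrib, Finset.prod_univ_sum, Fintype.piFinset_univ]

lemma randomState_const_mul (ω : Couplings Λ × Couplings Λ) (c : ℝ)
    (f : (Fin n → Config Λ) → ℝ) :
    randomState β Λ' t ω (fun σ => c * f σ) = c * randomState β Λ' t ω f := by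
  simp only [randomState, mul_assoc, ← Finset.mul_sum]
  ring

lemma randomState_sum (ω : Couplings Λ × Couplings Λ) {α : Type*} (s : Finset α)
    (f : α → (Fin n → Config Λ) → ℝ) :
    randomState β Λ' t ω (fun σ => ∑ a ∈ s, f a σ) = ∑ a ∈ s, randomState β Λ' t ω (f a) := by
  simp only [randomState, Finset.sum_mul, ← Finset.mul_sum]
  rw [Finset.sum_comm]

lemma measurable_randomState (f : (Fin n → Config Λ) → ℝ) :
    Measurable fun ω : Couplings Λ × Couplings Λ => randomState β Λ' t ω f := by
  have h_out (J : Couplings Λ) (σ : Config Λ) : hamOut Λ' J σ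
      = -∑ X : ↥Λ.powerset with ¬X.1 ⊆ Λ', J X * spinProd σ X := by
    simp only [hamOut, Finset.sum_filter, ite_not]
  simp only [randomState, partitionFn, interpHam, hamIn, h_out, ← Finset.sum_filter]
  fun_prop

end RandomState

lemma quenched_eq_integral_stdNormal (μ : ℝ) {n : ℕ} (t : Fin n → ℝ)
    (f : (Fin n → Config Λ) → ℝ) :
    quenched β Δ m m' Λ Λ' μ t f
      = ∫ g, randomState β Λ' t (couplings Δ m m' Λ Λ' μ g) f
        ∂stdNormal (↥Λ.powerset ⊕ ↥Λ.powerset) := by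
  have h_couplings := measurePreserving_couplings Δ m m' Λ Λ' μ
  rw [quenched, ← h_couplings.map_eq, integral_map h_couplings.measurable.aemeasurable
    (measurable_randomState β Λ' t f).aestronglyMeasurable]

variable {Λ Λ'}

lemma sum_inner_latticeModel (hsub : Λ' ⊆ Λ) (F : Finset (Site d) → ℝ) :
    ∑ X ∈ (latticeModel β Δ m m' Λ Λ').inner, F X = ∑ X ∈ Λ'.powerset, F X := by
  refine Finset.sum_nbij Subtype.val (fun X hX => ?_) Subtype.val_injective.injOn
    (fun X hX => ?_) fun _ _ => rfl
  · exact Finset.mem_powerset.2 (Finset.mem_filter.1 hX).2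
  · have hX_sub := Finset.mem_powerset.1 hX
    exact ⟨⟨X, Finset.mem_powerset.2 (hX_sub.trans hsub)⟩,
      Finset.mem_filter.2 ⟨Finset.mem_univ _, hX_sub⟩, rfl⟩

lemma normCov_mul_normCov (hsub : Λ' ⊆ Λ) (σ τ ρ π : Config Λ) :
    normCov Δ Λ' σ τ * normCov Δ Λ' ρ π
      = (∑ X ∈ (latticeModel β Δ m m' Λ Λ').inner, ∑ Y ∈ (latticeModel β Δ m m' Λ Λ').inner,
          Δ X ^ 2 * Δ Y ^ 2 * (spinProd σ X * spinProd τ X * spinProd ρ Y * spinProd π Y))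
        / (Λ'.card : ℝ) ^ 2 := by
  rw [normCov, normCov, ← sum_inner_latticeModel β Δ m m' hsub,
    ← sum_inner_latticeModel β Δ m m' hsub, div_mul_div_comm, Finset.sum_mul_sum, ← sq]
  congr! 3
  ring

lemma quenched_normCov_mul_normCov (hsub : Λ' ⊆ Λ) (μ : ℝ) {n : ℕ} (t : Fin n → ℝ)
    (i j k l : Fin n) :
    quenched β Δ m m' Λ Λ' μ t (fun σ => normCov Δ Λ' (σ i) (σ j) * normCov Δ Λ' (σ k) (σ l))
      = (latticeModel β Δ m m' Λ Λ').pairSum (fun g X Y =>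
          ∏ r, gibbs ((latticeModel β Δ m m' Λ Λ').logw μ (t r) g) fun σ =>
            (if r = i then spinProd σ X else 1) * (if r = j then spinProd σ X else 1)
              * (if r = k then spinProd σ Y else 1) * (if r = l then spinProd σ Y else 1))
        / (Λ'.card : ℝ) ^ 2 := by
  rw [quenched_eq_integral_stdNormal, RotatedModel.pairSum, ← integral_div]
  congr with g
  simp only [normCov_mul_normCov β Δ m m' hsub, div_eq_inv_mul, randomState_const_mul,
    randomState_sum, logw_latticeModel]
  congr! 5
  exact randomState_eq_prod_gibbs β Λ' t _ fun σ => by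
    simp only [Finset.prod_mul_distrib, Finset.prod_ite_eq', Finset.mem_univ, if_true]

lemma repliconPoly_eq (hsub : Λ' ⊆ Λ) (μ t s : ℝ) :
    repliconPoly β Δ m m' Λ Λ' μ t s
      = (latticeModel β Δ m m' Λ Λ').repliconPoly μ t s / (Λ'.card : ℝ) ^ 2 := by
  simp only [repliconPoly, sq (normCov _ _ _ _), quenched_normCov_mul_normCov β Δ m m' hsub]
  rw [RotatedModel.repliconPoly, RotatedModel.mixed, add_div, sub_div, mul_div_assoc]
  congr! 7
  · simp [RotatedModel.pairMag, spin_latticeModel]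
  · simp [Fin.prod_univ_three, RotatedModel.mag, RotatedModel.pairMag, spin_latticeModel]
  · simp [Fin.prod_univ_four, RotatedModel.mag, spin_latticeModel, mul_assoc]

lemma totalVar_latticeModel :
    (latticeModel β Δ m m' Λ Λ').totalVar = ∑ X ∈ Λ.powerset, Δ X ^ 2 :=
  Finset.sum_coe_sort Λ.powerset fun X => Δ X ^ 2

lemma totalMean_latticeModel (hsub : Λ' ⊆ Λ) :
    (latticeModel β Δ m m' Λ Λ').totalMean = ∑ X ∈ Λ'.powerset, |m' X| :=
  sum_inner_latticeModel β Δ m m' hsub fun X => |m' X|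

lemma integral_repliconPoly_eq (hsub : Λ' ⊆ Λ) (μ₁ μ₂ : ℝ) :
    ∫ μ in μ₁..μ₂, ∫ t in (0 : ℝ)..Real.pi, ∫ s in (0 : ℝ)..Real.pi,
        Real.sin (t - s) ^ 2 * repliconPoly β Δ m m' Λ Λ' μ t s
      = (∫ μ in μ₁..μ₂, ∫ t in (0 : ℝ)..Real.pi, ∫ s in (0 : ℝ)..Real.pi,
          Real.sin (t - s) ^ 2 * (latticeModel β Δ m m' Λ Λ').repliconPoly μ t s)
        / (Λ'.card : ℝ) ^ 2 := by
  simp only [repliconPoly_eq β Δ m m' hsub, ← mul_div_assoc,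
    intervalIntegral.integral_div]

end Lattice

section Limit

lemma ae_cos_add_sin_ne_zero :
    ∀ᵐ t : ℝ, t ∈ Set.uIoc 0 Real.pi → Real.cos t + Real.sin t ≠ 0 := by
  have h_subsingleton :
      {t : ℝ | t ∈ Set.uIoc 0 Real.pi ∧ Real.cos t + Real.sin t = 0}.Subsingleton := by
    rintro t ⟨ht, ht₀⟩ s ⟨hs, hs₀⟩
    rw [Set.uIoc_of_le Real.pi_pos.le] at ht hs
    have h_sin : Real.sin (t - s) = 0 := by
      rw [Real.sin_sub, eq_neg_of_add_eq_zero_right ht₀, eq_neg_of_add_eq_zero_right hs₀]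
      ring
    rw [Real.sin_eq_zero_iff_of_lt_of_lt (by linarith [ht.1, hs.2])
      (by linarith [ht.2, hs.1])] at h_sin
    exact sub_eq_zero.1 h_sin
  filter_upwards [measure_eq_zero_iff_ae_notMem.1 (h_subsingleton.measure_zero volume)]
    with t h ht h₀
  exact h ⟨ht, h₀⟩

lemma tendsto_card_of_tendsto_atTop {α β : Type*} [Infinite α] {l : Filter β} {Λ : β → Finset α}
    (h : Tendsto Λ l atTop) : Tendsto (fun n => ((Λ n).card : ℝ)) l atTop := by
  refine tendsto_natCast_atTop_atTop.comp (tendsto_atTop.2 fun k => ?_)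
  obtain ⟨s, hs⟩ := Infinite.exists_subset_card_eq α k
  filter_upwards [h.eventually_ge_atTop s] with n hn
  exact hs ▸ Finset.card_le_card hn

lemma tendsto_zero_of_le_add_mul {α : Type*} {l : Filter α} {f : α → ℝ} {e : ℝ → α → ℝ} {C : ℝ}
    (hf : ∀ᶠ x in l, 0 ≤ f x) (he : ∀ δ > 0, Tendsto (e δ) l (𝓝 0))
    (hle : ∀ δ > 0, ∀ᶠ x in l, f x ≤ e δ x + C * δ) : Tendsto f l (𝓝 0) := by
  refine tendsto_order.2 ⟨fun b hb => hf.mono fun x hx => hb.trans_le hx, fun b hb => ?_⟩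
  have h_lim : Tendsto (fun δ => C * δ) (𝓝[>] 0) (𝓝 0) :=
    (Continuous.tendsto' (by fun_prop) 0 0 (mul_zero C)).mono_left nhdsWithin_le_nhds
  obtain ⟨δ, hCδ, hδ⟩ :=
    ((h_lim.eventually_lt_const (half_pos hb)).and self_mem_nhdsWithin).exists
  filter_upwards [hle δ hδ, (he δ hδ).eventually_lt_const (half_pos hb)] with x hx he_x
  linarith

variable {α : Type*} {l : Filter α} {S ι : α → Type*} [∀ n, Fintype (S n)] [∀ n, Nonempty (S n)]
  [∀ n, Fintype (ι n)] [∀ n, DecidableEq (ι n)] {M : ∀ n, RotatedModel (S n) (ι n)} {V : α → ℝ}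
  {C μ₁ μ₂ : ℝ}

lemma tendsto_integral_varMagIn_div (hβ : ∀ n, (M n).β ≠ 0)
    (h_var : Tendsto (fun n => (M n).totalVar / V n ^ 2) l (𝓝 0))
    (h_mean : ∀ᶠ n in l, (M n).totalMean ^ 2 / V n ^ 2 ≤ C) (hμ : μ₁ ≤ μ₂) {t : ℝ}
    (ht : Real.cos t + Real.sin t ≠ 0) :
    Tendsto (fun n => (∫ μ in μ₁..μ₂, (M n).varMagIn μ t) / V n ^ 2) l (𝓝 0) := by
  refine tendsto_zero_of_le_add_mul (C := 8 * C)
    (e := fun δ n => (M n).totalVar / V n ^ 2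
      * (16 / ((Real.cos t + Real.sin t) * δ) ^ 2 * (μ₂ - μ₁)))
    (.of_forall fun n => div_nonneg
      (intervalIntegral.integral_nonneg hμ fun _ _ => variance_nonneg _ _) (sq_nonneg _))
    (fun δ _ => by simpa using h_var.mul_const _) fun δ hδ => ?_
  filter_upwards [h_mean] with n h_mean
  calc (∫ μ in μ₁..μ₂, (M n).varMagIn μ t) / V n ^ 2
      ≤ (16 * (M n).totalVar / ((Real.cos t + Real.sin t) * δ) ^ 2 * (μ₂ - μ₁)
          + 8 * (M n).totalMean ^ 2 * δ) / V n ^ 2 := by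
        gcongr
        exact (M n).integral_varMagIn_le (hβ n) ht hμ hδ
    _ = (M n).totalVar / V n ^ 2 * (16 / ((Real.cos t + Real.sin t) * δ) ^ 2 * (μ₂ - μ₁))
          + 8 * ((M n).totalMean ^ 2 / V n ^ 2) * δ := by ring
    _ ≤ _ := by gcongr

variable [l.IsCountablyGenerated]

lemma tendsto_integral_integral_varMagIn_div (hβ : ∀ n, (M n).β ≠ 0)
    (h_var : Tendsto (fun n => (M n).totalVar / V n ^ 2) l (𝓝 0))
    (h_mean : ∀ᶠ n in l, (M n).totalMean ^ 2 / V n ^ 2 ≤ C) (hμ : μ₁ ≤ μ₂) :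
    Tendsto (fun n => (∫ t in (0 : ℝ)..Real.pi, ∫ μ in μ₁..μ₂, (M n).varMagIn μ t) / V n ^ 2)
      l (𝓝 0) := by
  have h_bound : ∀ᶠ n in l, ∀ᵐ t : ℝ, t ∈ Set.uIoc 0 Real.pi →
      ‖(∫ μ in μ₁..μ₂, (M n).varMagIn μ t) / V n ^ 2‖ ≤ C * |μ₂ - μ₁| := by
    filter_upwards [h_mean] with n h_mean
    refine ae_of_all _ fun t _ => ?_
    have h_int : ‖∫ μ in μ₁..μ₂, (M n).varMagIn μ t‖ ≤ (M n).totalMean ^ 2 * |μ₂ - μ₁| :=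
      intervalIntegral.norm_integral_le_of_norm_le_const fun μ _ =>
        (Real.norm_of_nonneg (variance_nonneg _ _)).trans_le ((M n).varMagIn_le μ t)
    calc ‖(∫ μ in μ₁..μ₂, (M n).varMagIn μ t) / V n ^ 2‖
        ≤ (M n).totalMean ^ 2 * |μ₂ - μ₁| / V n ^ 2 := by
          rw [norm_div, norm_pow, Real.norm_eq_abs (V n), sq_abs]
          gcongr
      _ = (M n).totalMean ^ 2 / V n ^ 2 * |μ₂ - μ₁| := by ring
      _ ≤ C * |μ₂ - μ₁| := by gcongr
  have h_cont (n : α) : Continuous fun t => ∫ μ in μ₁..μ₂, (M n).varMagIn μ t :=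
    continuous_intervalIntegral (f := fun μ t => (M n).varMagIn μ t)
      (M n).continuous_varMagIn _ _
  have h_lim := intervalIntegral.tendsto_integral_filter_of_dominated_convergence
    (a := 0) (b := Real.pi) (μ := volume) (f := fun _ : ℝ => (0 : ℝ)) _
    (.of_forall fun n => ((h_cont n).div_const (V n ^ 2)).aestronglyMeasurable) h_bound
    intervalIntegrable_const
    (ae_cos_add_sin_ne_zero.mono fun t ht h_mem =>
      tendsto_integral_varMagIn_div hβ h_var h_mean hμ (ht h_mem))
  simpa only [intervalIntegral.integral_zero, intervalIntegral.integral_div] using h_lim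

lemma tendsto_integral_repliconPoly_div {β : ℝ} (hβ : β ≠ 0) (hMβ : ∀ n, (M n).β = β)
    (h_var : Tendsto (fun n => (M n).totalVar / V n ^ 2) l (𝓝 0))
    (h_mean : ∀ᶠ n in l, (M n).totalMean ^ 2 / V n ^ 2 ≤ C) (hμ : μ₁ ≤ μ₂) :
    Tendsto
      (fun n => (∫ μ in μ₁..μ₂, ∫ t in (0 : ℝ)..Real.pi, ∫ s in (0 : ℝ)..Real.pi,
        Real.sin (t - s) ^ 2 * (M n).repliconPoly μ t s) / V n ^ 2) l (𝓝 0) := by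
  have hMβ_ne (n : α) : (M n).β ≠ 0 := by rwa [hMβ]
  have h_lim : Tendsto (fun n => (β ^ 2)⁻¹
      * ((M n).totalVar / V n ^ 2 * ((Real.pi ^ 2 + 16) * (μ₂ - μ₁))
        + (∫ t in (0 : ℝ)..Real.pi, ∫ μ in μ₁..μ₂, (M n).varMagIn μ t) / V n ^ 2
          * (4 * Real.pi * (μ₁ ^ 2 + μ₂ ^ 2)))) l (𝓝 0) := by
    simpa using ((h_var.mul_const _).add ((tendsto_integral_integral_varMagIn_div hMβ_ne h_var
      h_mean hμ).mul_const _)).const_mul _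
  refine squeeze_zero_norm (fun n => ?_) h_lim
  have h_bound := (M n).sq_mul_abs_integral_integral_repliconPoly_le (hMβ_ne n) hμ
  rw [hMβ, ← le_inv_mul_iff₀ (by positivity)] at h_bound
  rw [norm_div, norm_pow, Real.norm_eq_abs, Real.norm_eq_abs, sq_abs]
  refine (div_le_div_of_nonneg_right h_bound (sq_nonneg _)).trans_eq ?_
  ring

end Limit

theorem theorem2_general {d : ℕ} {β : ℝ} (hβ : β ≠ 0) {Δ m m' : Finset (Site d) → ℝ}
    (hm' : ThermStable m' Δ) {Λ Λ' : ℕ → Finset (Site d)} (hsub : ∀ n, Λ' n ⊆ Λ n)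
    (hΛ' : ∀ᶠ n in atTop, (Λ' n).Nonempty)
    (hcard : Tendsto (fun n => ((Λ n).card : ℝ) / ((Λ' n).card : ℝ) ^ 2) atTop (𝓝 0))
    {μ₁ μ₂ : ℝ} (hμ : μ₁ ≤ μ₂) :
    Tendsto
      (fun n => ∫ μ in μ₁..μ₂, ∫ t in (0 : ℝ)..Real.pi, ∫ s in (0 : ℝ)..Real.pi,
        Real.sin (t - s) ^ 2 * repliconPoly β Δ m m' (Λ n) (Λ' n) μ t s)
      atTop (𝓝 0) := by
  obtain ⟨c, hc⟩ := hm'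
  simp only [integral_repliconPoly_eq β Δ m m' (hsub _)]
  refine tendsto_integral_repliconPoly_div (C := c ^ 2) hβ (fun _ => rfl) ?_ ?_ hμ
  · simp only [totalVar_latticeModel]
    refine squeeze_zero' (.of_forall fun n => by positivity) ?_
      (by simpa using hcard.const_mul c)
    filter_upwards [hΛ'] with n hn
    have hΛ_nonempty : (Λ n).Nonempty := hn.mono (hsub n)
    have h_var := (hc (Λ n) hΛ_nonempty).2
    rw [div_le_iff₀ (by exact_mod_cast hΛ_nonempty.card_pos)] at h_var
    rw [← mul_div_assoc]
    gcongr
  · filter_upwards [hΛ'] with n hn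
    rw [totalMean_latticeModel β Δ m m' (hsub n), ← div_pow]
    exact pow_le_pow_left₀ (by positivity) (hc (Λ' n) hn).1 2

end SpinFlip

end

theorem theorem2 (d : ℕ) (hd : 1 ≤ d) (β : ℝ) (hβ : 0 < β)
    (Δ m m' : Finset (SpinFlip.Site d) → ℝ)
    (hm : SpinFlip.ThermStable m Δ) (hm' : SpinFlip.ThermStable m' Δ)
    (Λ Λ' : ℕ → Finset (SpinFlip.Site d)) (hsub : ∀ n, Λ' n ⊆ Λ n)
    (hΛ : Tendsto Λ atTop atTop) (hΛ' : Tendsto Λ' atTop atTop)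
    (a : ℝ) (ha : 0 < a)
    (hratio : Tendsto (fun n => ((Λ' n).card : ℝ) / ((Λ n).card : ℝ)) atTop (𝓝 a))
    (μ₁ μ₂ : ℝ) (hμ : μ₁ ≤ μ₂) :
    Tendsto
      (fun n => ∫ μ in μ₁..μ₂, ∫ t in (0 : ℝ)..Real.pi, ∫ s in (0 : ℝ)..Real.pi,
        Real.sin (t - s) ^ 2 * SpinFlip.repliconPoly β Δ m m' (Λ n) (Λ' n) μ t s)
      atTop (𝓝 0) := by
  have : Nonempty (Fin d) := ⟨⟨0, hd⟩⟩
  have h_card := SpinFlip.tendsto_card_of_tendsto_atTop hΛ'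
  have h_nonempty : ∀ᶠ n in atTop, (Λ' n).Nonempty :=
    (h_card.eventually_gt_atTop 0).mono fun n hn => Finset.card_pos.1 (Nat.cast_pos.1 hn)
  refine SpinFlip.theorem2_general hβ.ne' hm' hsub h_nonempty ?_ hμ
  simpa [div_eq_mul_inv, sq, mul_assoc] using
    (hratio.inv₀ ha.ne').mul h_card.inv_tendsto_atTop
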